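/- Let $1\le m<n$, $p\ge 2$ and $p'=p/(p-1)$. Let $\omega_1\subset\mathbb R^m$ be open, bounded and convex with $0\in\omega_1$, let $\omega_2\subset\mathbb R^{n-m}$ be open and bounded, and set $\Omega_\ell=\ell\omega_1\times\omega_2$ for $\ell>0$. Write $x=(X_1,X_2)$ and $z=(Z_1,Z_2)$ for points of $\mathbb R^m\times\mathbb R^{n-m}=\mathbb R^n$. Let $F:\mathbb R^m\to\mathbb R$ and $G:\mathbb R^{n-m}\to\mathbb R$ be such that, for some constants $c_1>0$ and $0<\theta_1\le\theta_2$, $$\langle F^{p-1}(Z_1)\nabla F(Z_1)-F^{p-1}(W_1)\nabla F(W_1),\,Z_1-W_1\rangle\ge c_1|Z_1-W_1|^p,\qquad \theta_1|Z_1|\le F(Z_1)\le\theta_2|Z_1|$$ for all $Z_1,W_1\in\mathbb R^m$, and likewise $$\langle G^{p-1}(Z_2)\nabla G(Z_2)-G^{p-1}(W_2)\nabla G(W_2),\,Z_2-W_2\rangle\ge c_1|Z_2-W_2|^p,\qquad \theta_1|Z_2|\le G(Z_2)\le\theta_2|Z_2|$$ for all $Z_2,W_2\in\mathbb R^{n-m}$.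 Suppose that $H(z)=\left(F^p(Z_1)+G^p(Z_2)\right)^{1/p}$ is convex, positive and of class $C^1$ on $\mathbb R^n\setminus\{0\}$, and satisfies $H(tz)=|t|H(z)$ for all $t\in\mathbb R$, $z\in\mathbb R^n$. (Fields of the form $H^{p-1}\nabla H$ are understood to vanish at the origin.) Let $f\in L^{p'}(\omega_2)$, let $u_\ell\in W^{1,p}_0(\Omega_\ell)$ be the weak solution of $$-\mathrm{div}\left(H^{p-1}(\nabla u_\ell)\nabla H(\nabla u_\ell)\right)=f(X_2)\quad\text{in }\Omega_\ell,$$ that is, $\int_{\Omega_\ell}H^{p-1}(\nabla u_\ell)\langle\nabla H(\nabla u_\ell),\nabla\phi\rangle\,dx=\int_{\Omega_\ell}f(X_2)\phi\,dx$ for all $\phi\in W_0^{1,p}(\Omega_\ell)$, and let $u_\infty\in W^{1,p}_0(\omega_2)$ be the weak solution, in the same sense, of $$-\mathrm{div}\left(H^{p-1}(0,\nabla u_\infty)\,\nabla_{Z_2}H(0,\nabla u_\infty)\right)=f\quad\text{in }\omega_2,$$ extended to $\Omega_\ell$ by $u_\infty(X_1,X_2)=u_\infty(X_2)$. Then there are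 constants $C,\beta>0$ independent of $\ell$ such that, for every $\ell>0$, $$\|\nabla(u_\ell-u_\infty)\|_{L^p(\Omega_{\ell/2})}\le C e^{-\beta\ell}.$$ -/

import Mathlib

open MeasureTheory Set Filter Topology
open scoped ContDiff Pointwise InnerProductSpace

noncomputable section

section Sobolev

variable {E : Type*} [NormedAddCommGroup E] [InnerProductSpace ℝ E] [FiniteDimensional ℝ E]
  [MeasurableSpace E] [BorelSpace E]

/-- `φ ∈ C_c^∞(Ω)`. -/
structure IsTestFunction (Ω : Set E) (φ : E → ℝ) : Prop where
  smooth : ContDiff ℝ ∞ φ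
  compact : HasCompactSupport φ
  supp : tsupport φ ⊆ Ω

/-- `g` is a weak (distributional) gradient of `u` in the open set `Ω`; both are required to be
locally integrable, so that `g` is unique almost everywhere in `Ω`. -/
structure HasWeakGradient (Ω : Set E) (u : E → ℝ) (g : E → E) : Prop where
  locInt : LocallyIntegrableOn u Ω
  locInt_grad : LocallyIntegrableOn g Ω
  parts : ∀ φ : E → ℝ, IsTestFunction Ω φ →
    ∫ x in Ω, u x • gradient φ x = - ∫ x in Ω, φ x • g x

/-- `u ∈ W^{1,p}(Ω)` with weak gradient `∇u = g`. -/
structure MemSobolev (Ω : Set E) (p : ℝ) (u : E → ℝ) (g : E → E) : Prop where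
  weak : HasWeakGradient Ω u g
  memLp : MemLp u (ENNReal.ofReal p) (volume.restrict Ω)
  memLp_grad : MemLp g (ENNReal.ofReal p) (volume.restrict Ω)

/-- `u ∈ W_0^{1,p}(Ω)` with weak gradient `∇u = g`: the function `u` lies in `W^{1,p}(Ω)` and is a
limit of functions of `C_c^∞(Ω)` in the norm of `W^{1,p}(Ω)`. -/
structure MemSobolevZero (Ω : Set E) (p : ℝ) (u : E → ℝ) (g : E → E) : Prop where
  mem : MemSobolev Ω p u g
  approx : ∃ φ : ℕ → E → ℝ, (∀ j, IsTestFunction Ω (φ j)) ∧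
    Tendsto (fun j => eLpNorm (fun x => u x - φ j x) (ENNReal.ofReal p) (volume.restrict Ω))
      atTop (𝓝 0) ∧
    Tendsto (fun j => eLpNorm (fun x => g x - gradient (φ j) x) (ENNReal.ofReal p)
      (volume.restrict Ω)) atTop (𝓝 0)

/-- `u` is a weak solution of `-div (A (∇u)) = f` in `Ω`, `u ∈ W_0^{1,p}(Ω)`: there holds
`∫_Ω ⟨A(∇u), ∇φ⟩ = ∫_Ω f φ` for all `φ ∈ W_0^{1,p}(Ω)`. -/
def IsWeakSolution (Ω : Set E) (p : ℝ) (A : E → E) (f : E → ℝ) (u : E → ℝ) : Prop :=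
  ∃ g : E → E, MemSobolevZero Ω p u g ∧
    ∀ (φ : E → ℝ) (gφ : E → E), MemSobolevZero Ω p φ gφ →
      ∫ x in Ω, ⟪A (g x), gφ x⟫_ℝ = ∫ x in Ω, f x * φ x

end Sobolev

section Finsler

variable {E : Type*} [NormedAddCommGroup E] [InnerProductSpace ℝ E] [FiniteDimensional ℝ E]

/-- The standing assumptions on `H`: positive away from the origin, convex, absolutely homogeneous
of degree one, and of class `C^1` away from the origin. -/
structure IsFinsler (H : E → ℝ) : Prop where
  pos : ∀ z, z ≠ 0 → 0 < H z
  convex : ConvexOn ℝ univ H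
  homog : ∀ (t : ℝ) (z : E), H (t • z) = |t| * H z
  contDiff : ContDiffOn ℝ 1 H {0}ᶜ

/-- The vector field `z ↦ H(z)^{p-1} ∇H(z)`. For `p > 1` and `H(0) = 0` it vanishes at `z = 0`,
whatever value is given to `∇H(0)`. -/
def finslerFlux (p : ℝ) (H : E → ℝ) (z : E) : E := H z ^ (p - 1) • gradient H z

/-- Monotonicity of `z ↦ F(z)^{p-1} ∇F(z)` with constant `c₁`, and comparability of `F` with the
Euclidean norm with constants `θ₁`, `θ₂`. -/
structure IsMonotoneComparable (p c₁ θ₁ θ₂ : ℝ) (F : E → ℝ) : Prop where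
  mono : ∀ z w, c₁ * ‖z - w‖ ^ p ≤ ⟪finslerFlux p F z - finslerFlux p F w, z - w⟫_ℝ
  lower : ∀ z, θ₁ * ‖z‖ ≤ F z
  upper : ∀ z, F z ≤ θ₂ * ‖z‖

end Finsler

/-- The Euclidean space `ℝ^{m+k} = ℝ^m × ℝ^k`, with points `x = (X₁, X₂)`
(`X₁ = x.fst`, `X₂ = x.snd`), the Euclidean norm and the Lebesgue measure. -/
abbrev CylSpace (m k : ℕ) : Type :=
  WithLp 2 (EuclideanSpace ℝ (Fin m) × EuclideanSpace ℝ (Fin k))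

variable {m k : ℕ}

/-- The cylinder `Ω_ℓ = ℓ ω₁ × ω₂`. -/
def cylDomain (ω₁ : Set (EuclideanSpace ℝ (Fin m))) (ω₂ : Set (EuclideanSpace ℝ (Fin k)))
    (ℓ : ℝ) : Set (CylSpace m k) :=
  {x | x.fst ∈ ℓ • ω₁ ∧ x.snd ∈ ω₂}

/-- `H̃_q(z) = (F(Z₁)^q + G(Z₂)^q)^{1/q}`. -/
def splitFinsler (q : ℝ) (F : EuclideanSpace ℝ (Fin m) → ℝ) (G : EuclideanSpace ℝ (Fin k) → ℝ)
    (z : CylSpace m k) : ℝ :=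
  (F z.fst ^ q + G z.snd ^ q) ^ (1 / q)

/-- The vector field of the problem on the cross-section,
`Z₂ ↦ H(0, Z₂)^{p-1} ∇_{Z₂} H(0, Z₂)`. -/
def crossFlux (p : ℝ) (H : CylSpace m k → ℝ) (Z₂ : EuclideanSpace ℝ (Fin k)) :
    EuclideanSpace ℝ (Fin k) :=
  (finslerFlux p H (WithLp.toLp 2 (0, Z₂))).snd

end

/-!
Write `A = H^{p-1} ∇H` and `w = u - uInf`, with gradient `D`. Since `H^p = F^p + G^p` separates the
variables, so does the flux: `A(Z₁, Z₂) = (F^{p-1} ∇F(Z₁), G^{p-1} ∇G(Z₂))`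
(`finslerFlux_splitFinsler`). Hence the flux of the cross-section problem is the flux of `A` at
`(0, ∇uInf)`, the function `uInf` solves the same equation as `u` on the cylinder
(`integral_cyl_eq_of_cross_section`), and, what makes the decay exponential, the `X₁`-component of
the flux of `uInf` is zero, so that the `X₁`-component of the difference of the two fluxes is
bounded by `|D|^{p-1}`.

The difference of the two equations is tested with `(exp (α ψ(X₁)) - 1) w`, where `ψ` is a cut-off
of `ℓ ω₁` that equals `ℓ` on `(ℓ/2) ω₁` and whose gradient is bounded independently of `ℓ`. By
strong monotonicity of `A` the left side controls `(exp (α ψ) - 1) |D|^p`. The term with `∇ψ` is at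
most a multiple of `α exp (α ψ) |w| |D|^{p-1}`; as the weight depends on `X₁` only, Young's
inequality and Poincaré's inequality on the cross-sections bound its integral by a multiple of
`α ∫ exp (α ψ) |D|^p`, which is absorbed when `α` is small. This gives
`∫ exp (α ψ) |D|^p ≤ 2 ∫ |D|^p` (`integral_exp_mul_le`), so the energy of `w` in the cylinder over
`(ℓ/2) ω₁` is at most `2 exp (-α ℓ)` times the full energy. Testing the equation of `u` with `u`
shows that the full energy is `O(ℓ^m)` (`exists_energy_bound`), and the exponential absorbs the
power.

A function such as `w`, which vanishes on the lateral boundary of the cylinder but not on its ends,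
is described by smooth approximations supported over compact subsets of the cross-section
(`VanishesLaterally`). These approximations carry Poincaré's inequality over from test functions,
and show that a cut-off in `X₁` puts `w` in `W_0^{1,p}`.
-/

open MeasureTheory Set Filter Topology
open scoped ContDiff Pointwise InnerProductSpace

noncomputable section

/-! ### Elementary inequalities -/

section Elementary

/-- Young's inequality with explicit constants that are not sharp; it follows from comparing `b`
with `δ a`. -/
theorem rpow_sub_one_mul_le {p a b δ : ℝ} (hp : 1 < p) (ha : 0 ≤ a) (hb : 0 ≤ b) (hδ : 0 < δ) :
    a ^ (p - 1) * b ≤ δ * a ^ p + δ ^ (1 - p) * b ^ p := by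
  have mul_pow : ∀ {x : ℝ}, 0 ≤ x → x ^ (p - 1) * x = x ^ p := fun {x} hx => by
    rcases hx.eq_or_lt with rfl | h0
    · rw [Real.zero_rpow (by linarith : p ≠ 0), mul_zero]
    · rw [← Real.rpow_add_one h0.ne', sub_add_cancel]
  rcases le_total b (δ * a) with h | h
  · have : a ^ (p - 1) * b ≤ δ * a ^ p := by
      calc a ^ (p - 1) * b ≤ a ^ (p - 1) * (δ * a) := by gcongr
        _ = δ * (a ^ (p - 1) * a) := by ring
        _ = δ * a ^ p := by rw [mul_pow ha]
    have : 0 ≤ δ ^ (1 - p) * b ^ p := by positivity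
    linarith
  · have h1 : a ≤ δ⁻¹ * b := by rwa [inv_mul_eq_div, le_div_iff₀' hδ]
    have : a ^ (p - 1) * b ≤ δ ^ (1 - p) * b ^ p := by
      calc a ^ (p - 1) * b ≤ (δ⁻¹ * b) ^ (p - 1) * b := by gcongr
        _ = δ ^ (1 - p) * (b ^ (p - 1) * b) := by
          rw [Real.mul_rpow (inv_nonneg.2 hδ.le) hb, Real.inv_rpow hδ.le, ← Real.rpow_neg hδ.le,
            neg_sub, mul_assoc]
        _ = δ ^ (1 - p) * b ^ p := by rw [mul_pow hb]
    have : 0 ≤ δ * a ^ p := by positivity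
    linarith

theorem add_rpow_le_two_rpow_mul {p a b : ℝ} (hp : 0 ≤ p) (ha : 0 ≤ a) (hb : 0 ≤ b) :
    (a + b) ^ p ≤ 2 ^ p * (a ^ p + b ^ p) := by
  have hA : 0 ≤ a ^ p := by positivity
  have hB : 0 ≤ b ^ p := by positivity
  rcases le_total a b with h | h
  · calc (a + b) ^ p ≤ (2 * b) ^ p := by gcongr; linarith
      _ = 2 ^ p * b ^ p := Real.mul_rpow zero_le_two hb
      _ ≤ _ := by gcongr; linarith
  · calc (a + b) ^ p ≤ (2 * a) ^ p := by gcongr; linarith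
      _ = 2 ^ p * a ^ p := Real.mul_rpow zero_le_two ha
      _ ≤ _ := by gcongr; linarith

/-- Young's inequality with a prescribed small factor in front of `b ^ p`. -/
theorem exists_young {p ε : ℝ} (hp : 1 < p) (hε : 0 < ε) : ∃ M : ℝ, 0 < M ∧
    ∀ a b : ℝ, 0 ≤ a → 0 ≤ b → a ^ (p - 1) * b ≤ M * a ^ p + ε * b ^ p := by
  refine ⟨ε ^ (1 - p)⁻¹, by positivity, fun a b ha hb => ?_⟩
  have := rpow_sub_one_mul_le hp ha hb (δ := ε ^ (1 - p)⁻¹) (by positivity)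
  rwa [← Real.rpow_mul hε.le, inv_mul_cancel₀ (by linarith), Real.rpow_one] at this

theorem exists_pow_le_mul_exp (m : ℕ) {a : ℝ} (ha : 0 < a) :
    ∃ N : ℝ, 0 < N ∧ ∀ t : ℝ, 0 ≤ t → t ^ m ≤ N * Real.exp (a * t) := by
  refine ⟨m.factorial / a ^ m, by positivity, fun t ht => ?_⟩
  have h := Real.pow_div_factorial_le_exp (a * t) (by positivity) m
  rw [div_le_iff₀ (by positivity), mul_pow] at h
  rw [div_mul_eq_mul_div, le_div_iff₀ (by positivity)]
  linarith

end Elementary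

/-! ### Convergence in Lebesgue spaces -/

section LpLimits

variable {α F G W : Type*} [MeasurableSpace α] {μ : Measure α}
  [NormedAddCommGroup F] [NormedAddCommGroup G] [NormedAddCommGroup W]

theorem memLp_bilin [NormedSpace ℝ F] [NormedSpace ℝ G]
    [NormedSpace ℝ W] (B : F →L[ℝ] G →L[ℝ] W) {p q r : ENNReal} [ENNReal.HolderTriple q p r]
    {a : α → F} {v : α → G} (ha : MemLp a q μ) (hv : MemLp v p μ) :
    MemLp (fun x => B (a x) (v x)) r μ := by
  exact MemLp.of_bilin (r := r) (fun x y => B x y) ‖B‖₊ ha hv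
    (B.aestronglyMeasurable_comp₂ ha.1 hv.1) (.of_forall fun x => B.le_opNorm₂ _ _)

/-- Convergence in `L^p` may be paired with a fixed element of `L^q`. -/
theorem tendsto_integral_bilin [NormedSpace ℝ F] [NormedSpace ℝ G]
    [NormedSpace ℝ W] (B : F →L[ℝ] G →L[ℝ] W) {p q : ENNReal}
    [ENNReal.HolderTriple q p 1] {a : α → F} {v : α → G} {w : ℕ → α → G}
    (ha : MemLp a q μ) (hv : MemLp v p μ) (hw : ∀ j, MemLp (w j) p μ)
    (h : Tendsto (fun j => eLpNorm (fun x => v x - w j x) p μ) atTop (𝓝 0)) :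
    Tendsto (fun j => ∫ x, B (a x) (w j x) ∂μ) atTop (𝓝 (∫ x, B (a x) (v x) ∂μ)) := by
  refine tendsto_integral_of_L1' _ (B.aestronglyMeasurable_comp₂ ha.1 hv.1)
    (.of_forall fun j => memLp_one_iff_integrable.1 (memLp_bilin (p := p) (q := q) B ha (hw j))) ?_
  have h2 : Tendsto (fun j => ‖B‖₊ * eLpNorm a q μ * eLpNorm (fun x => v x - w j x) p μ) atTop
      (𝓝 0) := by
    have := ENNReal.Tendsto.const_mul (a := ‖B‖₊ * eLpNorm a q μ) h
      (Or.inr (ENNReal.mul_ne_top ENNReal.coe_ne_top ha.2.ne))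
    simpa using this
  refine tendsto_of_tendsto_of_tendsto_of_le_of_le tendsto_const_nhds h2 (fun _ => zero_le) ?_
  intro j
  have := eLpNorm_le_eLpNorm_mul_eLpNorm_of_nnnorm (p := q) (q := p) (r := 1)
    ha.1 (hv.1.sub (hw j).1) (fun x y => B x y) ‖B‖₊ (.of_forall fun x => B.le_opNorm₂ _ _)
  have e : (fun x => B (a x) (w j x)) - (fun x => B (a x) (v x)) =
      -(fun x => B (a x) ((v - w j) x)) := by
    ext x
    simp
  beta_reduce
  rw [e, eLpNorm_neg]
  exact this

theorem eLpNorm_ofReal_rpow {p : ℝ} (hp : 0 < p) (f : α → F) :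
    eLpNorm f (ENNReal.ofReal p) μ ^ p = ∫⁻ x, ‖f x‖ₑ ^ p ∂μ := by
  rw [eLpNorm_eq_lintegral_rpow_enorm_toReal (by simpa using hp) ENNReal.ofReal_ne_top,
    ENNReal.toReal_ofReal hp.le, one_div, ENNReal.rpow_inv_rpow hp.ne']

theorem lintegral_enorm_rpow_eq_ofReal {p : ℝ} (hp : 0 < p) {f : α → F}
    (hf : MemLp f (ENNReal.ofReal p) μ) :
    ∫⁻ x, ‖f x‖ₑ ^ p ∂μ = ENNReal.ofReal (∫ x, ‖f x‖ ^ p ∂μ) := by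
  have hi := hf.integrable_norm_rpow (by simpa using hp) ENNReal.ofReal_ne_top
  rw [ENNReal.toReal_ofReal hp.le] at hi
  rw [ofReal_integral_eq_lintegral_ofReal hi (.of_forall fun x => by positivity)]
  refine lintegral_congr fun x => ?_
  rw [← ENNReal.ofReal_rpow_of_nonneg (norm_nonneg _) hp.le, ofReal_norm]

theorem integrable_norm_rpow_ofReal {p : ℝ} (hp : 0 < p) {f : α → F}
    (hf : MemLp f (ENNReal.ofReal p) μ) : Integrable (fun x => ‖f x‖ ^ p) μ := by
  have hi := hf.integrable_norm_rpow (by simpa using hp) ENNReal.ofReal_ne_top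
  rwa [ENNReal.toReal_ofReal hp.le] at hi

theorem tendsto_eLpNorm_add {q : ENNReal} (hq : 1 ≤ q) {a b : ℕ → α → F}
    (ha : ∀ j, AEStronglyMeasurable (a j) μ) (hb : ∀ j, AEStronglyMeasurable (b j) μ)
    (h1 : Tendsto (fun j => eLpNorm (a j) q μ) atTop (𝓝 0))
    (h2 : Tendsto (fun j => eLpNorm (b j) q μ) atTop (𝓝 0)) :
    Tendsto (fun j => eLpNorm (fun x => a j x + b j x) q μ) atTop (𝓝 0) := by
  refine tendsto_of_tendsto_of_tendsto_of_le_of_le tendsto_const_nhds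
    (by simpa using h1.add h2) (fun _ => zero_le) fun j => eLpNorm_add_le (ha j) (hb j) hq

theorem tendsto_eLpNorm_of_norm_le_mul {q : ENNReal} {a : ℕ → α → F} {b : ℕ → α → G} (B : ℝ)
    (hab : ∀ j x, ‖a j x‖ ≤ B * ‖b j x‖)
    (h : Tendsto (fun j => eLpNorm (b j) q μ) atTop (𝓝 0)) :
    Tendsto (fun j => eLpNorm (a j) q μ) atTop (𝓝 0) := by
  have h2 : Tendsto (fun j => ENNReal.ofReal B * eLpNorm (b j) q μ) atTop (𝓝 0) := by
    simpa using ENNReal.Tendsto.const_mul h (Or.inr (ENNReal.ofReal_ne_top (r := B)))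
  exact tendsto_of_tendsto_of_tendsto_of_le_of_le tendsto_const_nhds h2 (fun _ => zero_le)
    fun j => eLpNorm_le_mul_eLpNorm_of_ae_le_mul (.of_forall (hab j)) q

/-- An inequality between `L^q` norms passes to limits in `L^q`. -/
theorem eLpNorm_le_mul_of_tendsto {q C : ENNReal} (hq : 1 ≤ q) (hC : C ≠ ⊤) {a : α → F}
    {b : α → G} {aj : ℕ → α → F} {bj : ℕ → α → G}
    (ha : AEStronglyMeasurable a μ) (hb : AEStronglyMeasurable b μ)
    (haj : ∀ j, AEStronglyMeasurable (aj j) μ) (hbj : ∀ j, AEStronglyMeasurable (bj j) μ)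
    (h1 : Tendsto (fun j => eLpNorm (fun x => a x - aj j x) q μ) atTop (𝓝 0))
    (h2 : Tendsto (fun j => eLpNorm (fun x => b x - bj j x) q μ) atTop (𝓝 0))
    (h : ∀ j, eLpNorm (aj j) q μ ≤ C * eLpNorm (bj j) q μ) :
    eLpNorm a q μ ≤ C * eLpNorm b q μ := by
  have hlim : Tendsto (fun j => eLpNorm (fun x => a x - aj j x) q μ +
      C * (eLpNorm (fun x => b x - bj j x) q μ + eLpNorm b q μ)) atTop
      (𝓝 (0 + C * (0 + eLpNorm b q μ))) :=
    h1.add (ENNReal.Tendsto.const_mul (h2.add tendsto_const_nhds) (Or.inr hC))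
  rw [zero_add, zero_add] at hlim
  refine ge_of_tendsto' hlim fun j => ?_
  calc eLpNorm a q μ = eLpNorm ((fun x => a x - aj j x) + aj j) q μ := by
        congr 1
        ext x
        simp
    _ ≤ eLpNorm (fun x => a x - aj j x) q μ + eLpNorm (aj j) q μ :=
        eLpNorm_add_le (ha.sub (haj j)) (haj j) hq
    _ ≤ _ := by
        gcongr
        refine (h j).trans ?_
        gcongr
        calc eLpNorm (bj j) q μ = eLpNorm (b - (fun x => b x - bj j x)) q μ := by
              congr 1
              ext x
              simp
          _ ≤ eLpNorm b q μ + eLpNorm (fun x => b x - bj j x) q μ :=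
              eLpNorm_sub_le hb (hb.sub (hbj j)) hq
          _ = _ := add_comm _ _

/-- A field of growth `p - 1` maps `L^p` to the dual Lebesgue space. -/
theorem memLp_of_norm_le_rpow {p Λ : ℝ} (hp : 1 < p) {g : α → F} {b : α → G}
    (hg : MemLp g (ENNReal.ofReal p) μ) (hb : AEStronglyMeasurable b μ)
    (hbg : ∀ x, ‖b x‖ ≤ Λ * ‖g x‖ ^ (p - 1)) : MemLp b (ENNReal.ofReal (p / (p - 1))) μ := by
  have h := hg.norm_rpow_div (ENNReal.ofReal (p - 1))
  rw [← ENNReal.ofReal_div_of_pos (by linarith), ENNReal.toReal_ofReal (by linarith)] at h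
  refine h.of_le_mul (c := Λ) hb (.of_forall fun x => ?_)
  rw [Real.norm_of_nonneg (Real.rpow_nonneg (norm_nonneg _) _)]
  exact hbg x

end LpLimits

/-! ### Gradients of smooth functions -/

section Gradient

variable {E : Type*} [NormedAddCommGroup E] [InnerProductSpace ℝ E] [FiniteDimensional ℝ E]

theorem continuous_gradient {v : E → ℝ} (hv : ContDiff ℝ 1 v) : Continuous (gradient v) :=
  (InnerProductSpace.toDual ℝ E).symm.continuous.comp (hv.continuous_fderiv one_ne_zero)

theorem tsupport_gradient_subset (v : E → ℝ) : tsupport (gradient v) ⊆ tsupport v := by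
  refine closure_minimal (fun x hx => support_fderiv_subset ℝ (f := v) ?_) isClosed_closure
  intro h
  apply hx
  simp [gradient, h]

theorem gradient_eq_zero_of_notMem_tsupport {v : E → ℝ} {x : E} (hx : x ∉ tsupport v) :
    gradient v x = 0 := by
  by_contra h
  exact hx (tsupport_gradient_subset v (subset_tsupport _ h))

omit [FiniteDimensional ℝ E] in
theorem IsTestFunction.contDiff_one {Ω : Set E} {φ : E → ℝ} (h : IsTestFunction Ω φ) :
    ContDiff ℝ 1 φ := h.smooth.of_le (by exact_mod_cast le_top)

theorem IsTestFunction.hasCompactSupport_gradient {Ω : Set E} {φ : E → ℝ}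
    (h : IsTestFunction Ω φ) : HasCompactSupport (gradient φ) :=
  h.compact.mono' ((subset_tsupport _).trans (tsupport_gradient_subset φ))

end Gradient

/-! ### Closedness of the weak gradient -/

section Sobolev

variable {E : Type*} [NormedAddCommGroup E] [InnerProductSpace ℝ E] [FiniteDimensional ℝ E]
  [MeasurableSpace E] [BorelSpace E]

omit [FiniteDimensional ℝ E] in
theorem IsTestFunction.memLp {Ω : Set E} {φ : E → ℝ} (h : IsTestFunction Ω φ) (p : ENNReal)
    (μ : Measure E) [IsFiniteMeasureOnCompacts μ] : MemLp φ p μ :=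
  h.smooth.continuous.memLp_of_hasCompactSupport h.compact

theorem IsTestFunction.memLp_gradient {Ω : Set E} {φ : E → ℝ} (h : IsTestFunction Ω φ)
    (p : ENNReal) (μ : Measure E) [IsFiniteMeasureOnCompacts μ] : MemLp (gradient φ) p μ :=
  (continuous_gradient h.contDiff_one).memLp_of_hasCompactSupport
    h.hasCompactSupport_gradient

/-- Integration by parts of a `C^1` function against a test function. -/
theorem integral_smul_gradient_eq_neg {Ω : Set E} {v φ : E → ℝ} (hv : ContDiff ℝ 1 v)
    (hφ : IsTestFunction Ω φ) :
    ∫ x in Ω, v x • gradient φ x = - ∫ x in Ω, φ x • gradient v x := by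
  have cφ := hφ.contDiff_one
  have gφc := hφ.hasCompactSupport_gradient
  have i1 : Integrable (fun x => v x • gradient φ x) (volume : Measure E) :=
    (hv.continuous.smul (continuous_gradient cφ)).integrable_of_hasCompactSupport gφc.smul_left
  have i2 : Integrable (fun x => φ x • gradient v x) (volume : Measure E) :=
    (cφ.continuous.smul (continuous_gradient hv)).integrable_of_hasCompactSupport
      hφ.compact.smul_right
  rw [setIntegral_eq_integral_of_forall_compl_eq_zero (fun x hx => by
      rw [gradient_eq_zero_of_notMem_tsupport fun h => hx (hφ.supp h), smul_zero]),
    setIntegral_eq_integral_of_forall_compl_eq_zero (fun x hx => by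
      rw [image_eq_zero_of_notMem_tsupport fun h => hx (hφ.supp h), zero_smul])]
  refine ext_inner_left ℝ fun e => ?_
  rw [inner_neg_right, ← integral_inner i1, ← integral_inner i2]
  have j3 : Integrable (fun x => v x * φ x) (volume : Measure E) :=
    (hv.continuous.mul cφ.continuous).integrable_of_hasCompactSupport hφ.compact.mul_left
  have := integral_mul_fderiv_eq_neg_fderiv_mul_of_integrable (μ := (volume : Measure E))
    (f := v) (g := φ) (v := e) ?_ ?_ j3 (fun x _ => hv.differentiable one_ne_zero x)
      (fun x _ => cφ.differentiable one_ne_zero x)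
  · simpa [inner_smul_right, inner_gradient_right, mul_comm] using this
  · refine (i2.const_inner e).congr (.of_forall fun x => ?_)
    simp [inner_smul_right, inner_gradient_right, mul_comm]
  · refine (i1.const_inner e).congr (.of_forall fun x => ?_)
    simp [inner_smul_right, inner_gradient_right]

theorem locallyIntegrableOn_of_memLp_ofReal {V : Type*} [NormedAddCommGroup V] {Ω : Set E}
    {v : E → V} {p : ℝ} (hp : 1 ≤ p)
    (hv : MemLp v (ENNReal.ofReal p) (volume.restrict Ω)) : LocallyIntegrableOn v Ω := by
  exact locallyIntegrableOn_of_locallyIntegrable_restrict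
    (hv.locallyIntegrable (by simpa using hp))

theorem holderTriple_ofReal {p : ℝ} (hp : 1 < p) :
    ENNReal.HolderTriple (ENNReal.ofReal (p / (p - 1))) (ENNReal.ofReal p) 1 := by
  have h : Real.HolderConjugate (p / (p - 1)) p :=
    (Real.HolderConjugate.conjExponent hp).symm
  exact h.ennrealOfReal

/-- The weak gradient is closed: if `C^1` functions and their gradients converge in `L^p(Ω)`, the
limit of the gradients is a weak gradient of the limit. -/
theorem hasWeakGradient_of_tendsto {Ω : Set E} {p : ℝ} (hp : 1 < p)
    {v : E → ℝ} {g : E → E} {w : ℕ → E → ℝ}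
    (hv : MemLp v (ENNReal.ofReal p) (volume.restrict Ω))
    (hg : MemLp g (ENNReal.ofReal p) (volume.restrict Ω))
    (hw : ∀ j, ContDiff ℝ 1 (w j))
    (hw1 : ∀ j, MemLp (w j) (ENNReal.ofReal p) (volume.restrict Ω))
    (hw2 : ∀ j, MemLp (gradient (w j)) (ENNReal.ofReal p) (volume.restrict Ω))
    (h1 : Tendsto (fun j => eLpNorm (fun x => v x - w j x) (ENNReal.ofReal p)
      (volume.restrict Ω)) atTop (𝓝 0))
    (h2 : Tendsto (fun j => eLpNorm (fun x => g x - gradient (w j) x) (ENNReal.ofReal p)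
      (volume.restrict Ω)) atTop (𝓝 0)) :
    HasWeakGradient Ω v g where
  locInt := locallyIntegrableOn_of_memLp_ofReal hp.le hv
  locInt_grad := locallyIntegrableOn_of_memLp_ofReal hp.le hg
  parts φ hφ := by
    have := holderTriple_ofReal hp
    have l1 := tendsto_integral_bilin (ContinuousLinearMap.lsmul ℝ ℝ : ℝ →L[ℝ] E →L[ℝ] E).flip
      (hφ.memLp_gradient (ENNReal.ofReal (p / (p - 1))) (volume.restrict Ω)) hv hw1 h1
    have l2 := tendsto_integral_bilin (ContinuousLinearMap.lsmul ℝ ℝ : ℝ →L[ℝ] E →L[ℝ] E)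
      (hφ.memLp (ENNReal.ofReal (p / (p - 1))) (volume.restrict Ω)) hg hw2 h2
    refine tendsto_nhds_unique (l1.congr fun j => ?_) l2.neg
    exact integral_smul_gradient_eq_neg (hw j) hφ

/-- For `L^p` functions the approximation by test functions alone gives membership in
`W_0^{1,p}(Ω)`: the weak gradient is then automatic. -/
theorem memSobolevZero_of_tendsto {Ω : Set E} {p : ℝ} (hp : 1 < p)
    {v : E → ℝ} {g : E → E} {w : ℕ → E → ℝ}
    (hv : MemLp v (ENNReal.ofReal p) (volume.restrict Ω))
    (hg : MemLp g (ENNReal.ofReal p) (volume.restrict Ω))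
    (hw : ∀ j, IsTestFunction Ω (w j))
    (h1 : Tendsto (fun j => eLpNorm (fun x => v x - w j x) (ENNReal.ofReal p)
      (volume.restrict Ω)) atTop (𝓝 0))
    (h2 : Tendsto (fun j => eLpNorm (fun x => g x - gradient (w j) x) (ENNReal.ofReal p)
      (volume.restrict Ω)) atTop (𝓝 0)) :
    MemSobolevZero Ω p v g where
  mem := ⟨hasWeakGradient_of_tendsto hp hv hg (fun j => (hw j).contDiff_one)
    (fun j => (hw j).memLp _ _) (fun j => (hw j).memLp_gradient _ _) h1 h2, hv, hg⟩
  approx := ⟨w, hw, h1, h2⟩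

theorem IsTestFunction.memSobolevZero {Ω : Set E} {p : ℝ} (hp : 1 < p) {φ : E → ℝ}
    (h : IsTestFunction Ω φ) : MemSobolevZero Ω p φ (gradient φ) :=
  memSobolevZero_of_tendsto hp (h.memLp _ _) (h.memLp_gradient _ _) (fun _ => h)
    (by simp) (by simp)

end Sobolev

/-! ### The flux of a Finsler function -/

section Finsler

variable {E : Type*} [NormedAddCommGroup E] [InnerProductSpace ℝ E] [FiniteDimensional ℝ E]
  {N : E → ℝ} {p θ : ℝ}

omit [FiniteDimensional ℝ E] in
theorem IsFinsler.map_zero (h : IsFinsler N) : N 0 = 0 := by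
  simpa using h.homog 0 0

omit [FiniteDimensional ℝ E] in
theorem IsFinsler.nonneg (h : IsFinsler N) (z : E) : 0 ≤ N z := by
  rcases eq_or_ne z 0 with rfl | hz
  · exact h.map_zero.ge
  · exact (h.pos z hz).le

omit [FiniteDimensional ℝ E] in
theorem IsFinsler.add_le (h : IsFinsler N) (z w : E) : N (z + w) ≤ N z + N w := by
  have h1 := h.convex.2 (mem_univ z) (mem_univ w) (by norm_num : (0 : ℝ) ≤ 1 / 2)
    (by norm_num : (0 : ℝ) ≤ 1 / 2) (by norm_num)
  rw [← smul_add, h.homog, smul_eq_mul, smul_eq_mul, abs_of_pos (by norm_num)] at h1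
  linarith

omit [FiniteDimensional ℝ E] in
/-- Convexity and homogeneity make `N` subadditive, so that an upper bound by a multiple of the norm
is a Lipschitz bound. -/
theorem IsFinsler.lipschitzWith (h : IsFinsler N) (hθ : ∀ z, N z ≤ θ * ‖z‖) :
    LipschitzWith θ.toNNReal N := by
  refine LipschitzWith.of_le_add_mul _ fun z w => ?_
  have h1 := h.add_le w (z - w)
  rw [add_sub_cancel] at h1
  have h2 := hθ (z - w)
  rw [← dist_eq_norm] at h2
  have h3 : θ * dist z w ≤ θ.toNNReal * dist z w := by
    gcongr
    exact Real.le_coe_toNNReal θ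
  linarith

theorem IsFinsler.norm_gradient_le (h : IsFinsler N) (hθ₀ : 0 ≤ θ) (hθ : ∀ z, N z ≤ θ * ‖z‖)
    (z : E) : ‖gradient N z‖ ≤ θ := by
  have := norm_fderiv_le_of_lipschitz ℝ (h.lipschitzWith hθ) (x₀ := z)
  rw [Real.coe_toNNReal θ hθ₀] at this
  simpa [gradient] using this

theorem IsFinsler.finslerFlux_zero (h : IsFinsler N) (hp : 1 < p) : finslerFlux p N 0 = 0 := by
  rw [finslerFlux, h.map_zero, Real.zero_rpow (by linarith), zero_smul]

theorem IsFinsler.norm_finslerFlux_le (h : IsFinsler N) (hp : 1 < p) (hθ₀ : 0 ≤ θ)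
    (hθ : ∀ z, N z ≤ θ * ‖z‖) (z : E) : ‖finslerFlux p N z‖ ≤ θ ^ p * ‖z‖ ^ (p - 1) := by
  rw [finslerFlux, norm_smul, Real.norm_of_nonneg (Real.rpow_nonneg (h.nonneg z) _)]
  calc N z ^ (p - 1) * ‖gradient N z‖ ≤ (θ * ‖z‖) ^ (p - 1) * θ := by
        gcongr
        · exact h.nonneg z
        · exact hθ z
        · exact h.norm_gradient_le hθ₀ hθ z
    _ = θ ^ p * ‖z‖ ^ (p - 1) := by
        rw [Real.mul_rpow hθ₀ (norm_nonneg z), mul_right_comm]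
        congr 1
        rcases hθ₀.eq_or_lt with rfl | h0
        · rw [Real.zero_rpow (by linarith), Real.zero_rpow (by linarith), zero_mul]
        · rw [← Real.rpow_add_one h0.ne', sub_add_cancel]

theorem measurable_finslerFlux [MeasurableSpace E] [BorelSpace E] (h : Measurable N) :
    Measurable (finslerFlux p N) :=
  (h.pow_const _).smul
    ((InnerProductSpace.toDual ℝ E).symm.continuous.measurable.comp (measurable_fderiv ℝ N))

/-- The field `N^{p-1} ∇N` is the gradient of `N^p / p`, also at the origin, where `N` itself is
not differentiable. -/
theorem IsFinsler.hasGradientAt_rpow (h : IsFinsler N) (hp : 1 < p)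
    (hθ : ∀ z, N z ≤ θ * ‖z‖) (z : E) :
    HasGradientAt (fun y => N y ^ p) (p • finslerFlux p N z) z := by
  rcases eq_or_ne z 0 with rfl | hz
  · rw [h.finslerFlux_zero hp, smul_zero, hasGradientAt_iff_isLittleO]
    simp only [h.map_zero, Real.zero_rpow (by linarith : p ≠ 0), sub_zero, inner_zero_left]
    have h1 : (fun y : E => N y ^ p) =O[𝓝 0] fun y => ‖y‖ ^ p := by
      refine Asymptotics.IsBigO.of_bound (θ ^ p) (.of_forall fun y => ?_)
      rw [Real.norm_of_nonneg (Real.rpow_nonneg (h.nonneg y) _),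
        Real.norm_of_nonneg (Real.rpow_nonneg (norm_nonneg y) _)]
      rcases eq_or_ne y 0 with rfl | hy
      · simp [h.map_zero, Real.zero_rpow (by linarith : p ≠ 0)]
      · have hθ₀ : 0 ≤ θ := by
          by_contra! hlt
          have := mul_neg_of_neg_of_pos hlt (norm_pos_iff.2 hy)
          linarith [hθ y, h.nonneg y]
        rw [← Real.mul_rpow hθ₀ (norm_nonneg y)]
        exact Real.rpow_le_rpow (h.nonneg y) (hθ y) (by linarith)
    refine h1.trans_isLittleO ?_
    have h2 : Tendsto (fun y : E => ‖y‖ ^ (p - 1)) (𝓝 0) (𝓝 0) := by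
      have : ContinuousAt (fun y : E => ‖y‖ ^ (p - 1)) 0 :=
        continuous_norm.continuousAt.rpow_const (Or.inr (by linarith))
      simpa [ContinuousAt, Real.zero_rpow (by linarith : p - 1 ≠ 0)] using this
    have h3 := ((Asymptotics.isLittleO_one_iff ℝ).2 h2).mul_isBigO
      (Asymptotics.isBigO_refl (fun y : E => ‖y‖) (𝓝 0))
    refine (Asymptotics.isLittleO_norm_right.1 ?_)
    refine h3.congr (fun y => ?_) (fun y => by simp)
    rcases eq_or_ne y 0 with rfl | hy
    · simp [Real.zero_rpow (by linarith : p ≠ 0)]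
    · rw [← Real.rpow_add_one (norm_ne_zero_iff.2 hy), sub_add_cancel]
  · have hd : DifferentiableAt ℝ N z :=
      (h.contDiff.contDiffAt (isOpen_compl_singleton.mem_nhds hz)).differentiableAt one_ne_zero
    rw [hasGradientAt_iff_hasFDerivAt]
    have := hd.hasFDerivAt.rpow_const (p := p) (Or.inl (h.pos z hz).ne')
    refine this.congr_fderiv ?_
    ext y
    simp [finslerFlux, mul_assoc]

end Finsler

/-! ### Splitting of the flux on the product space -/

section Split

variable {m k : ℕ} {p θ : ℝ} {F : EuclideanSpace ℝ (Fin m) → ℝ}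
  {G : EuclideanSpace ℝ (Fin k) → ℝ}

theorem splitFinsler_toLp_fst (hp : 0 < p) (hF : ∀ z, 0 ≤ F z) (hG : G 0 = 0)
    (z : EuclideanSpace ℝ (Fin m)) : splitFinsler p F G (WithLp.toLp 2 (z, 0)) = F z := by
  rw [splitFinsler, WithLp.toLp_fst, WithLp.toLp_snd, hG, Real.zero_rpow hp.ne', add_zero,
    one_div, Real.rpow_rpow_inv (hF z) hp.ne']

theorem splitFinsler_toLp_snd (hp : 0 < p) (hF : F 0 = 0) (hG : ∀ z, 0 ≤ G z)
    (z : EuclideanSpace ℝ (Fin k)) : splitFinsler p F G (WithLp.toLp 2 (0, z)) = G z := by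
  rw [splitFinsler, WithLp.toLp_fst, WithLp.toLp_snd, hF, Real.zero_rpow hp.ne', zero_add,
    one_div, Real.rpow_rpow_inv (hG z) hp.ne']

/-- The restriction of a Finsler function along an injective linear map is a Finsler function. -/
theorem IsFinsler.comp {E E' : Type*} [NormedAddCommGroup E] [InnerProductSpace ℝ E]
    [NormedAddCommGroup E'] [InnerProductSpace ℝ E'] {N : E → ℝ} (h : IsFinsler N)
    (L : E' →L[ℝ] E) (hL : Function.Injective L) : IsFinsler (fun z => N (L z)) where
  pos z hz := h.pos _ fun h0 => hz (hL (h0.trans L.map_zero.symm))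
  convex := h.convex.comp_linearMap L.toLinearMap
  homog t z := by rw [L.map_smul, h.homog]
  contDiff := h.contDiff.comp L.contDiff.contDiffOn
    fun z hz h0 => hz (hL (Eq.trans h0 L.map_zero.symm))

theorem IsFinsler.of_split_fst (hp : 0 < p) (hF : ∀ z, 0 ≤ F z) (hG : G 0 = 0)
    (h : IsFinsler (splitFinsler p F G)) : IsFinsler F := by
  have h1 := h.comp ((WithLp.prodContinuousLinearEquiv 2 ℝ (EuclideanSpace ℝ (Fin m))
      (EuclideanSpace ℝ (Fin k))).symm.toContinuousLinearMap.comp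
    (ContinuousLinearMap.inl ℝ _ _)) fun x y hxy => by simpa using hxy
  convert h1 using 2 with z
  exact (splitFinsler_toLp_fst hp hF hG z).symm

theorem IsFinsler.of_split_snd (hp : 0 < p) (hF : F 0 = 0) (hG : ∀ z, 0 ≤ G z)
    (h : IsFinsler (splitFinsler p F G)) : IsFinsler G := by
  have h1 := h.comp ((WithLp.prodContinuousLinearEquiv 2 ℝ (EuclideanSpace ℝ (Fin m))
      (EuclideanSpace ℝ (Fin k))).symm.toContinuousLinearMap.comp
    (ContinuousLinearMap.inr ℝ _ _)) fun x y hxy => by simpa using hxy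
  convert h1 using 2 with z
  exact (splitFinsler_toLp_snd hp hF hG z).symm

theorem CylSpace.norm_fst_le (z : CylSpace m k) : ‖z.fst‖ ≤ ‖z‖ := by
  rw [WithLp.prod_norm_eq_of_L2]
  exact Real.le_sqrt_of_sq_le (by nlinarith [sq_nonneg ‖z.snd‖])

theorem CylSpace.norm_snd_le (z : CylSpace m k) : ‖z.snd‖ ≤ ‖z‖ := by
  rw [WithLp.prod_norm_eq_of_L2]
  exact Real.le_sqrt_of_sq_le (by nlinarith [sq_nonneg ‖z.fst‖])

theorem CylSpace.norm_le_fst_add_snd (z : CylSpace m k) : ‖z‖ ≤ ‖z.fst‖ + ‖z.snd‖ := by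
  rw [WithLp.prod_norm_eq_of_L2]
  exact Real.sqrt_le_iff.2 ⟨by positivity, by nlinarith [norm_nonneg z.fst, norm_nonneg z.snd]⟩

theorem splitFinsler_le (hp : 1 ≤ p) (hθ₀ : 0 ≤ θ) (hF₀ : ∀ z, 0 ≤ F z) (hG₀ : ∀ z, 0 ≤ G z)
    (hF : ∀ z, F z ≤ θ * ‖z‖) (hG : ∀ z, G z ≤ θ * ‖z‖) (z : CylSpace m k) :
    splitFinsler p F G z ≤ (2 * θ) * ‖z‖ := by
  calc splitFinsler p F G z ≤ F z.fst + G z.snd :=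
        Real.rpow_add_rpow_le_add (hF₀ _) (hG₀ _) hp
    _ ≤ θ * ‖z.fst‖ + θ * ‖z.snd‖ := add_le_add (hF _) (hG _)
    _ ≤ θ * ‖z‖ + θ * ‖z‖ := by
        gcongr
        · exact CylSpace.norm_fst_le z
        · exact CylSpace.norm_snd_le z
    _ = (2 * θ) * ‖z‖ := by ring

/-- Since `H^p = F^p + G^p` separates the variables, so does the flux `H^{p-1} ∇H`. -/
theorem finslerFlux_splitFinsler (hp : 1 < p) (hθ₀ : 0 ≤ θ)
    (hH : IsFinsler (splitFinsler p F G)) (hF₀ : IsFinsler F) (hG₀ : IsFinsler G)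
    (hF : ∀ z, F z ≤ θ * ‖z‖) (hG : ∀ z, G z ≤ θ * ‖z‖) (z : CylSpace m k) :
    finslerFlux p (splitFinsler p F G) z =
      WithLp.toLp 2 (finslerFlux p F z.fst, finslerFlux p G z.snd) := by
  have h1 := hH.hasGradientAt_rpow hp
    (splitFinsler_le hp.le hθ₀ hF₀.nonneg hG₀.nonneg hF hG) z
  have e : (fun y => splitFinsler p F G y ^ p) =
      fun y : CylSpace m k => F y.fst ^ p + G y.snd ^ p := by
    ext y
    rw [splitFinsler, one_div, Real.rpow_inv_rpow (add_nonneg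
      (Real.rpow_nonneg (hF₀.nonneg _) _) (Real.rpow_nonneg (hG₀.nonneg _) _)) (by linarith)]
  rw [e] at h1
  have hf : HasFDerivAt (fun y : CylSpace m k => F y.fst ^ p) _ z :=
    (hF₀.hasGradientAt_rpow hp hF z.fst).hasFDerivAt.comp z
      (WithLp.fstL 2 ℝ (EuclideanSpace ℝ (Fin m)) (EuclideanSpace ℝ (Fin k))).hasFDerivAt
  have hg : HasFDerivAt (fun y : CylSpace m k => G y.snd ^ p) _ z :=
    (hG₀.hasGradientAt_rpow hp hG z.snd).hasFDerivAt.comp z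
      (WithLp.sndL 2 ℝ (EuclideanSpace ℝ (Fin m)) (EuclideanSpace ℝ (Fin k))).hasFDerivAt
  have h2 : HasGradientAt (fun y : CylSpace m k => F y.fst ^ p + G y.snd ^ p)
      (p • WithLp.toLp 2 (finslerFlux p F z.fst, finslerFlux p G z.snd)) z := by
    rw [hasGradientAt_iff_hasFDerivAt]
    refine (hf.add hg).congr_fderiv ?_
    ext y
    simp [WithLp.prod_inner_apply, mul_add]
  exact smul_right_injective _ (by linarith : p ≠ 0) (h1.unique h2)

end Split

/-! ### Poincaré inequality for test functions -/

section Poincare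

variable {E : Type*} [NormedAddCommGroup E] [InnerProductSpace ℝ E] [FiniteDimensional ℝ E]
  [MeasurableSpace E] [BorelSpace E]

theorem IsTestFunction.integrable_rpow {Ω : Set E} {φ : E → ℝ} (h : IsTestFunction Ω φ)
    {p : ℝ} (hp : 0 < p) : Integrable (fun x => ‖φ x‖ ^ p) (volume : Measure E) :=
  integrable_norm_rpow_ofReal hp (h.memLp _ _)

theorem IsTestFunction.integrable_gradient_rpow {Ω : Set E} {φ : E → ℝ}
    (h : IsTestFunction Ω φ) {p : ℝ} (hp : 0 < p) :
    Integrable (fun x => ‖gradient φ x‖ ^ p) (volume : Measure E) :=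
  integrable_norm_rpow_ofReal hp (h.memLp_gradient _ _)

/-- Poincaré inequality. It comes from integrating `∂ₑ⟨e, x⟩ = 1` by parts against `|φ|^p` for a
unit vector `e`. -/
theorem IsTestFunction.poincare_of_subset_closedBall [Nontrivial E] {Ω : Set E} {R p : ℝ}
    (hR : 0 < R) (hΩ : Ω ⊆ Metric.closedBall 0 R) (hp : 2 ≤ p) {φ : E → ℝ}
    (h : IsTestFunction Ω φ) :
    ∫ x, ‖φ x‖ ^ p ≤ (2 * (R * p)) ^ p * ∫ x, ‖gradient φ x‖ ^ p := by
  obtain ⟨e, he⟩ := exists_norm_eq E zero_le_one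
  have hc := h.smooth.continuous
  have hgc := continuous_gradient h.contDiff_one
  -- `d` is the derivative of `|φ|^p` in the direction `e`
  set d : E → ℝ := fun x => (p * |φ x| ^ (p - 2) * φ x) * ⟪gradient φ x, e⟫_ℝ with hd
  have hdc : Continuous d :=
    ((continuous_const.mul (hc.abs.rpow_const fun _ => Or.inr (by linarith))).mul hc).mul
      (hgc.inner continuous_const)
  have hac : Continuous fun x => |φ x| ^ p := hc.abs.rpow_const fun _ => Or.inr (by linarith)
  have hsupp : HasCompactSupport fun x => |φ x| ^ p :=
    h.compact.comp_left (g := fun t : ℝ => |t| ^ p) (by simp [show p ≠ 0 by linarith])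
  have hdsupp : HasCompactSupport d :=
    (h.compact.mul_left (f := fun x => p * |φ x| ^ (p - 2))).mul_right
  have hderiv : ∀ x, HasLineDerivAt ℝ (fun x => |φ x| ^ p) (d x) x e := by
    intro x
    have h1 := (h.contDiff_one.differentiable one_ne_zero x).hasFDerivAt
    have h2 : HasFDerivAt (fun x => |φ x| ^ p) _ x :=
      (hasDerivAt_abs_rpow (φ x) (by linarith : 1 < p)).comp_hasFDerivAt x h1
    have := h2.hasLineDerivAt e
    simpa [hd] using this
  have hib := integral_bilinear_hasLineDerivAt_right_eq_neg_left_of_integrable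
    (μ := (volume : Measure E)) (B := ContinuousLinearMap.mul ℝ ℝ)
    (f := fun x => ⟪e, x⟫_ℝ) (f' := fun _ => 1) (g := fun x => |φ x| ^ p) (g' := d) (v := e)
    ?_ ?_ ?_ ?_ (fun x _ => hderiv x)
  rotate_left
  · exact (continuous_const.mul hac).integrable_of_hasCompactSupport hsupp.mul_left
  · exact ((continuous_const.inner continuous_id).mul hdc).integrable_of_hasCompactSupport
      hdsupp.mul_left
  · exact ((continuous_const.inner continuous_id).mul hac).integrable_of_hasCompactSupport
      hsupp.mul_left
  · intro x _
    have := (innerSL ℝ e).hasFDerivAt (x := x) |>.hasLineDerivAt e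
    simpa [he] using this
  simp only [ContinuousLinearMap.mul_apply', one_mul] at hib
  have hRp : 0 < R * p := mul_pos hR (by linarith)
  have hpt : ∀ x, -(⟪e, x⟫_ℝ * d x) ≤
      1 / 2 * ‖φ x‖ ^ p + 1 / 2 * (2 * (R * p)) ^ p * ‖gradient φ x‖ ^ p := by
    intro x
    by_cases hx : x ∈ tsupport φ
    · -- the choice of `δ` leaves half of `‖φ‖ ^ p`, which the left side absorbs
      have hxR : ‖x‖ ≤ R := by simpa using hΩ (h.supp hx)
      have y := rpow_sub_one_mul_le (p := p) (a := ‖φ x‖) (b := ‖gradient φ x‖)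
        (δ := (2 * (R * p))⁻¹) (by linarith) (norm_nonneg _) (norm_nonneg _) (by positivity)
      have hd1 : ‖d x‖ ≤ p * (‖φ x‖ ^ (p - 1) * ‖gradient φ x‖) := by
        rw [hd]
        simp only [norm_mul, Real.norm_eq_abs p, abs_of_pos (by linarith : 0 < p)]
        rw [Real.norm_of_nonneg (Real.rpow_nonneg (abs_nonneg (φ x)) _), mul_assoc p, mul_assoc p]
        gcongr
        · refine le_of_eq ?_
          rw [Real.norm_eq_abs]
          rcases eq_or_ne (φ x) 0 with h0 | h0
          · simp [h0, Real.zero_rpow (by linarith : p - 1 ≠ 0)]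
          · rw [← Real.rpow_add_one (abs_ne_zero.2 h0)]
            congr 1
            ring
        · refine (norm_inner_le_norm _ _).trans ?_
          rw [he, mul_one]
      have hi : ‖⟪e, x⟫_ℝ‖ ≤ R := by
        refine (norm_inner_le_norm _ _).trans ?_
        rwa [he, one_mul]
      calc -(⟪e, x⟫_ℝ * d x) ≤ ‖⟪e, x⟫_ℝ * d x‖ := neg_le_abs _
        _ ≤ R * (p * (‖φ x‖ ^ (p - 1) * ‖gradient φ x‖)) := by
            rw [norm_mul]
            gcongr
        _ = R * p * (‖φ x‖ ^ (p - 1) * ‖gradient φ x‖) := by ring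
        _ ≤ R * p * ((2 * (R * p))⁻¹ * ‖φ x‖ ^ p +
              (2 * (R * p))⁻¹ ^ (1 - p) * ‖gradient φ x‖ ^ p) := by gcongr
        _ = _ := by
            rw [mul_add, Real.inv_rpow (by positivity), ← Real.rpow_neg (by positivity), neg_sub,
              Real.rpow_sub_one (by positivity)]
            field_simp
    · rw [hd]
      simp only [image_eq_zero_of_notMem_tsupport hx, mul_zero, zero_mul, neg_zero]
      positivity
  have i1 := h.integrable_rpow (p := p) (by linarith)
  have i2 := h.integrable_gradient_rpow (p := p) (by linarith)
  have hm := integral_mono (μ := (volume : Measure E)) (f := fun x => -(⟪e, x⟫_ℝ * d x)) ?_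
    ((i1.const_mul (1 / 2)).add (i2.const_mul (1 / 2 * (2 * (R * p)) ^ p))) hpt
  · simp only [Pi.add_apply] at hm
    rw [integral_neg, integral_add (i1.const_mul _) (i2.const_mul _), integral_const_mul,
      integral_const_mul, hib, neg_neg] at hm
    simp only [Real.norm_eq_abs (φ _)] at hm ⊢
    linarith
  · exact (((continuous_const.inner continuous_id).mul hdc).integrable_of_hasCompactSupport
      hdsupp.mul_left).neg

/-- Poincaré inequality for test functions supported in a bounded set. -/
theorem exists_poincare [Nontrivial E] {Ω : Set E} (hΩ : Bornology.IsBounded Ω) {p : ℝ}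
    (hp : 2 ≤ p) : ∃ K : ℝ, 0 < K ∧ ∀ φ : E → ℝ, IsTestFunction Ω φ →
      ∫⁻ x in Ω, ‖φ x‖ₑ ^ p ≤ ENNReal.ofReal K * ∫⁻ x in Ω, ‖gradient φ x‖ₑ ^ p := by
  obtain ⟨R, hR, hΩR⟩ := hΩ.subset_closedBall_lt 0 0
  refine ⟨(2 * (R * p)) ^ p, by positivity, fun φ h => ?_⟩
  have hp0 : 0 < p := by linarith
  have key := h.poincare_of_subset_closedBall hR hΩR hp
  have e1 : ∫⁻ x in Ω, ‖φ x‖ₑ ^ p = ENNReal.ofReal (∫ x, ‖φ x‖ ^ p) := by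
    rw [← lintegral_enorm_rpow_eq_ofReal hp0 (h.memLp _ _), setLIntegral_eq_of_support_subset]
    intro x hx
    by_contra hn
    exact hx (by simp [image_eq_zero_of_notMem_tsupport fun hs => hn (h.supp hs), hp0])
  have e2 : ∫⁻ x in Ω, ‖gradient φ x‖ₑ ^ p = ENNReal.ofReal (∫ x, ‖gradient φ x‖ ^ p) := by
    rw [← lintegral_enorm_rpow_eq_ofReal hp0 (h.memLp_gradient _ _),
      setLIntegral_eq_of_support_subset]
    intro x hx
    by_contra hn
    exact hx (by simp [gradient_eq_zero_of_notMem_tsupport fun hs => hn (h.supp hs), hp0])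
  rw [e1, e2, ← ENNReal.ofReal_mul (by positivity)]
  exact ENNReal.ofReal_le_ofReal key

end Poincare

/-! ### Integration and differentiation on cylinders -/

section Cylinder

variable {m k : ℕ} {p : ℝ} {S : Set (EuclideanSpace ℝ (Fin m))} {T : Set (EuclideanSpace ℝ (Fin k))}

/-- The cylinder `S × T` in `ℝ^m × ℝ^k`. -/
def cyl (S : Set (EuclideanSpace ℝ (Fin m))) (T : Set (EuclideanSpace ℝ (Fin k))) :
    Set (CylSpace m k) :=
  {x | x.fst ∈ S ∧ x.snd ∈ T}

theorem cyl_mono {S' : Set (EuclideanSpace ℝ (Fin m))} (h : S ⊆ S') :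
    cyl S T ⊆ cyl S' T := fun _ hx => ⟨h hx.1, hx.2⟩

theorem measurePreserving_ofLp_cyl (S : Set (EuclideanSpace ℝ (Fin m)))
    (T : Set (EuclideanSpace ℝ (Fin k))) (hS : MeasurableSet S) (hT : MeasurableSet T) :
    MeasurePreserving (fun x : CylSpace m k => x.ofLp) (volume.restrict (cyl S T))
      ((volume.restrict S).prod (volume.restrict T)) := by
  rw [Measure.prod_restrict]
  exact (WithLp.volume_preserving_ofLp _ _).restrict_preimage (hS.prod hT)

theorem measurableEmbedding_ofLp : MeasurableEmbedding (fun x : CylSpace m k => x.ofLp) :=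
  (WithLp.prodContinuousLinearEquiv 2 ℝ (EuclideanSpace ℝ (Fin m))
    (EuclideanSpace ℝ (Fin k))).toHomeomorph.measurableEmbedding

theorem lintegral_cyl (hS : MeasurableSet S) (hT : MeasurableSet T) {f : CylSpace m k → ENNReal}
    (hf : Measurable f) :
    ∫⁻ x in cyl S T, f x = ∫⁻ X in S, ∫⁻ Y in T, f (WithLp.toLp 2 (X, Y)) := by
  have hm : Measurable fun z : EuclideanSpace ℝ (Fin m) × EuclideanSpace ℝ (Fin k) =>
      f (WithLp.toLp 2 z) := hf.comp (WithLp.prod_continuous_toLp 2 _ _).measurable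
  rw [← lintegral_prod _ hm.aemeasurable,
    ← (measurePreserving_ofLp_cyl S T hS hT).lintegral_comp hm]

theorem integral_cyl (hS : MeasurableSet S) (hT : MeasurableSet T) {f : CylSpace m k → ℝ}
    (hf : Integrable f (volume.restrict (cyl S T))) :
    ∫ x in cyl S T, f x = ∫ X in S, ∫ Y in T, f (WithLp.toLp 2 (X, Y)) := by
  have mp := measurePreserving_ofLp_cyl S T hS hT
  have e : f = (fun z => f (WithLp.toLp 2 z)) ∘ fun x : CylSpace m k => x.ofLp := rfl
  have hi : Integrable (fun z => f (WithLp.toLp 2 z))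
      ((volume.restrict S).prod (volume.restrict T)) := by
    rw [e] at hf
    exact (mp.integrable_comp_emb measurableEmbedding_ofLp).1 hf
  rw [← integral_prod _ hi, ← mp.integral_comp measurableEmbedding_ofLp]

theorem map_snd_cyl (hS : MeasurableSet S) (hT : MeasurableSet T) :
    (volume.restrict (cyl S T)).map (fun x : CylSpace m k => x.snd) =
      volume S • volume.restrict T := by
  have := (measurePreserving_ofLp_cyl S T hS hT).map_eq
  have h2 : (fun x : CylSpace m k => x.snd) = Prod.snd ∘ fun x : CylSpace m k => x.ofLp := rfl
  rw [h2, ← Measure.map_map measurable_snd measurableEmbedding_ofLp.measurable, this,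
    Measure.map_snd_prod, Measure.restrict_apply_univ]

theorem measurable_cyl_snd : Measurable fun x : CylSpace m k => x.snd :=
  measurable_snd.comp measurableEmbedding_ofLp.measurable

theorem measurable_cyl_fst : Measurable fun x : CylSpace m k => x.fst :=
  measurable_fst.comp measurableEmbedding_ofLp.measurable

variable {V : Type*} [NormedAddCommGroup V]

theorem aestronglyMeasurable_comp_snd (hS : MeasurableSet S) (hT : MeasurableSet T)
    {h : EuclideanSpace ℝ (Fin k) → V} (hh : AEStronglyMeasurable h (volume.restrict T)) :
    AEStronglyMeasurable (fun x : CylSpace m k => h x.snd) (volume.restrict (cyl S T)) := by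
  refine AEStronglyMeasurable.comp_measurable (f := fun x : CylSpace m k => x.snd) ?_
    measurable_cyl_snd
  rw [map_snd_cyl hS hT]
  exact hh.smul_measure _

theorem eLpNorm_comp_snd (hS : MeasurableSet S) (hT : MeasurableSet T) (hp : 0 < p)
    {h : EuclideanSpace ℝ (Fin k) → V} (hh : AEStronglyMeasurable h (volume.restrict T)) :
    eLpNorm (fun x : CylSpace m k => h x.snd) (ENNReal.ofReal p) (volume.restrict (cyl S T)) =
      volume S ^ (1 / p) * eLpNorm h (ENNReal.ofReal p) (volume.restrict T) := by
  have := eLpNorm_map_measure (p := ENNReal.ofReal p) (μ := volume.restrict (cyl S T))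
    (f := fun x : CylSpace m k => x.snd) (g := h)
    (by rw [map_snd_cyl hS hT]; exact hh.smul_measure _) measurable_cyl_snd.aemeasurable
  rw [map_snd_cyl hS hT, eLpNorm_smul_measure_of_ne_top ENNReal.ofReal_ne_top,
    ENNReal.toReal_div, ENNReal.toReal_one, ENNReal.toReal_ofReal hp.le] at this
  exact this.symm

theorem memLp_comp_snd (hS : MeasurableSet S) (hT : MeasurableSet T) (hfin : volume S ≠ ⊤)
    (hp : 0 < p) {h : EuclideanSpace ℝ (Fin k) → V}
    (hh : MemLp h (ENNReal.ofReal p) (volume.restrict T)) :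
    MemLp (fun x : CylSpace m k => h x.snd) (ENNReal.ofReal p) (volume.restrict (cyl S T)) := by
  refine ⟨aestronglyMeasurable_comp_snd hS hT hh.1, ?_⟩
  rw [eLpNorm_comp_snd hS hT hp hh.1]
  exact ENNReal.mul_lt_top (ENNReal.rpow_lt_top_of_nonneg (by positivity) hfin) hh.2

/-- The embedding of `ℝ^k` in `ℝ^m × ℝ^k` as `{0} × ℝ^k`. -/
def inrL (m k : ℕ) : EuclideanSpace ℝ (Fin k) →L[ℝ] CylSpace m k :=
  (WithLp.prodContinuousLinearEquiv 2 ℝ (EuclideanSpace ℝ (Fin m))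
      (EuclideanSpace ℝ (Fin k))).symm.toContinuousLinearMap.comp (ContinuousLinearMap.inr ℝ _ _)

/-- The embedding of `ℝ^m` in `ℝ^m × ℝ^k` as `ℝ^m × {0}`. -/
def inlL (m k : ℕ) : EuclideanSpace ℝ (Fin m) →L[ℝ] CylSpace m k :=
  (WithLp.prodContinuousLinearEquiv 2 ℝ (EuclideanSpace ℝ (Fin m))
      (EuclideanSpace ℝ (Fin k))).symm.toContinuousLinearMap.comp (ContinuousLinearMap.inl ℝ _ _)

@[simp] theorem inrL_fst (y : EuclideanSpace ℝ (Fin k)) : (inrL m k y).fst = 0 := rfl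
@[simp] theorem inrL_snd (y : EuclideanSpace ℝ (Fin k)) : (inrL m k y).snd = y := rfl
@[simp] theorem inlL_fst (y : EuclideanSpace ℝ (Fin m)) : (inlL m k y).fst = y := rfl
@[simp] theorem inlL_snd (y : EuclideanSpace ℝ (Fin m)) : (inlL m k y).snd = 0 := rfl

theorem inrL_eq (y : EuclideanSpace ℝ (Fin k)) : inrL m k y = WithLp.toLp 2 (0, y) := rfl

theorem toLp_eq_inlL_add_inrL (X : EuclideanSpace ℝ (Fin m)) (Y : EuclideanSpace ℝ (Fin k)) :
    WithLp.toLp 2 (X, Y) = inlL m k X + inrL m k Y := by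
  have h : (X, Y) = (X, 0) + (0, Y) := by simp
  rw [h]
  rfl

@[simp] theorem inner_inrL (y : EuclideanSpace ℝ (Fin k)) (x : CylSpace m k) :
    ⟪inrL m k y, x⟫_ℝ = ⟪y, x.snd⟫_ℝ := by
  simp [WithLp.prod_inner_apply]

@[simp] theorem inner_inlL (y : EuclideanSpace ℝ (Fin m)) (x : CylSpace m k) :
    ⟪inlL m k y, x⟫_ℝ = ⟪y, x.fst⟫_ℝ := by
  simp [WithLp.prod_inner_apply]

theorem norm_inrL (y : EuclideanSpace ℝ (Fin k)) : ‖inrL m k y‖ = ‖y‖ := by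
  simp [WithLp.prod_norm_eq_of_L2]

theorem norm_inlL (y : EuclideanSpace ℝ (Fin m)) : ‖inlL m k y‖ = ‖y‖ := by
  simp [WithLp.prod_norm_eq_of_L2]

theorem gradient_comp_snd {ψ : EuclideanSpace ℝ (Fin k) → ℝ} (hψ : ContDiff ℝ 1 ψ)
    (x : CylSpace m k) :
    gradient (fun x : CylSpace m k => ψ x.snd) x = inrL m k (gradient ψ x.snd) := by
  refine HasGradientAt.gradient ?_
  rw [hasGradientAt_iff_hasFDerivAt]
  have h1 : HasFDerivAt (fun x : CylSpace m k => ψ x.snd) _ x :=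
    (hψ.differentiable one_ne_zero x.snd).hasFDerivAt.comp x
      (WithLp.sndL 2 ℝ (EuclideanSpace ℝ (Fin m)) (EuclideanSpace ℝ (Fin k))).hasFDerivAt
  refine h1.congr_fderiv ?_
  ext y
  simp

theorem gradient_comp_fst {ψ : EuclideanSpace ℝ (Fin m) → ℝ} (hψ : ContDiff ℝ 1 ψ)
    (x : CylSpace m k) :
    gradient (fun x : CylSpace m k => ψ x.fst) x = inlL m k (gradient ψ x.fst) := by
  refine HasGradientAt.gradient ?_
  rw [hasGradientAt_iff_hasFDerivAt]
  have h1 : HasFDerivAt (fun x : CylSpace m k => ψ x.fst) _ x :=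
    (hψ.differentiable one_ne_zero x.fst).hasFDerivAt.comp x
      (WithLp.fstL 2 ℝ (EuclideanSpace ℝ (Fin m)) (EuclideanSpace ℝ (Fin k))).hasFDerivAt
  refine h1.congr_fderiv ?_
  ext y
  simp

theorem contDiff_comp_snd {n : WithTop ℕ∞} {ψ : EuclideanSpace ℝ (Fin k) → ℝ}
    (hψ : ContDiff ℝ n ψ) : ContDiff ℝ n fun x : CylSpace m k => ψ x.snd :=
  hψ.comp (WithLp.sndL 2 ℝ (EuclideanSpace ℝ (Fin m)) (EuclideanSpace ℝ (Fin k))).contDiff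

theorem contDiff_comp_fst {n : WithTop ℕ∞} {ψ : EuclideanSpace ℝ (Fin m) → ℝ}
    (hψ : ContDiff ℝ n ψ) : ContDiff ℝ n fun x : CylSpace m k => ψ x.fst :=
  hψ.comp (WithLp.fstL 2 ℝ (EuclideanSpace ℝ (Fin m)) (EuclideanSpace ℝ (Fin k))).contDiff

/-- The gradient of the restriction of `v` to `{X} × ℝ^k` is the `X₂`-component of `∇v`. -/
theorem gradient_slice {v : CylSpace m k → ℝ} (hv : ContDiff ℝ 1 v)
    (X : EuclideanSpace ℝ (Fin m)) (Y : EuclideanSpace ℝ (Fin k)) :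
    gradient (fun Y => v (WithLp.toLp 2 (X, Y))) Y = (gradient v (WithLp.toLp 2 (X, Y))).snd := by
  refine HasGradientAt.gradient ?_
  rw [hasGradientAt_iff_hasFDerivAt]
  have h0 : HasFDerivAt (fun Y => (WithLp.toLp 2 (X, Y) : CylSpace m k)) (inrL m k) Y := by
    simp only [toLp_eq_inlL_add_inrL]
    exact (inrL m k).hasFDerivAt.const_add _
  have h1 : HasFDerivAt (fun Y => v (WithLp.toLp 2 (X, Y))) _ Y :=
    (hv.differentiable one_ne_zero (WithLp.toLp 2 (X, Y))).hasFDerivAt.comp Y h0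
  refine h1.congr_fderiv ?_
  ext y
  rw [InnerProductSpace.toDual_apply_apply, real_inner_comm, ← inner_inrL, real_inner_comm,
    inner_gradient_left]
  rfl

theorem IsTestFunction.slice {φ : CylSpace m k → ℝ} (h : IsTestFunction (cyl S T) φ)
    (X : EuclideanSpace ℝ (Fin m)) : IsTestFunction T fun Y => φ (WithLp.toLp 2 (X, Y)) := by
  have hc : Continuous fun Y => (WithLp.toLp 2 (X, Y) : CylSpace m k) := by
    simp only [toLp_eq_inlL_add_inrL]
    fun_prop
  have hsub : tsupport (fun Y => φ (WithLp.toLp 2 (X, Y))) ⊆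
      (fun Y => (WithLp.toLp 2 (X, Y) : CylSpace m k)) ⁻¹' tsupport φ :=
    closure_minimal (fun Y hY => subset_tsupport φ hY) ((isClosed_tsupport φ).preimage hc)
  refine ⟨?_, ?_, fun Y hY => (h.supp (hsub hY)).2⟩
  · simp only [toLp_eq_inlL_add_inrL]
    exact h.smooth.comp (contDiff_const.add (inrL m k).contDiff)
  · have hcomp : IsCompact ((fun x : CylSpace m k => x.snd) '' tsupport φ) :=
      h.compact.isCompact.image (WithLp.sndL 2 ℝ (EuclideanSpace ℝ (Fin m))
        (EuclideanSpace ℝ (Fin k))).continuous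
    exact hcomp.of_isClosed_subset (isClosed_tsupport _) fun Y hY => ⟨_, hsub hY, rfl⟩

/-- Poincaré inequality in the cross-sections of a cylinder, with a weight that depends on `X₁`
only. -/
theorem lintegral_cyl_poincare {K : ENNReal} (hS : MeasurableSet S) (hT : MeasurableSet T)
    (hp : 0 < p)
    (hK : ∀ φ : EuclideanSpace ℝ (Fin k) → ℝ, IsTestFunction T φ →
      ∫⁻ x in T, ‖φ x‖ₑ ^ p ≤ K * ∫⁻ x in T, ‖gradient φ x‖ₑ ^ p)
    {s : EuclideanSpace ℝ (Fin m) → ℝ} (hs : Continuous s) {v : CylSpace m k → ℝ}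
    (hv : ContDiff ℝ 1 v) (hvt : ∀ X, IsTestFunction T fun Y => v (WithLp.toLp 2 (X, Y))) :
    ∫⁻ x in cyl S T, ‖s x.fst * v x‖ₑ ^ p ≤
      K * ∫⁻ x in cyl S T, ‖s x.fst • gradient v x‖ₑ ^ p := by
  have hsm : Measurable fun x : CylSpace m k => s x.fst := hs.measurable.comp measurable_cyl_fst
  have hgm := (continuous_gradient hv).measurable
  have m2 : Measurable fun x : CylSpace m k => ‖s x.fst • gradient v x‖ₑ ^ p :=
    (hsm.smul hgm).enorm.pow_const p
  have m1 : Measurable fun x : CylSpace m k => ‖s x.fst * v x‖ₑ ^ p :=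
    (hsm.mul hv.continuous.measurable).enorm.pow_const p
  rw [lintegral_cyl hS hT m1, lintegral_cyl hS hT m2, ← lintegral_const_mul]
  · refine lintegral_mono fun X => ?_
    have hg : ∀ Y, ‖gradient (fun Y => v (WithLp.toLp 2 (X, Y))) Y‖ₑ ≤
        ‖gradient v (WithLp.toLp 2 (X, Y))‖ₑ := fun Y => by
      rw [gradient_slice hv, enorm_le_iff_norm_le]
      exact CylSpace.norm_snd_le _
    simp only [WithLp.toLp_fst, enorm_mul, enorm_smul, ENNReal.mul_rpow_of_nonneg _ _ hp.le]
    rw [lintegral_const_mul' _ _ (ENNReal.rpow_ne_top_of_nonneg hp.le enorm_ne_top),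
      lintegral_const_mul' _ _ (ENNReal.rpow_ne_top_of_nonneg hp.le enorm_ne_top),
      mul_left_comm]
    gcongr
    refine (hK _ (hvt X)).trans ?_
    gcongr with Y
    exact hg Y
  · exact (m2.comp (WithLp.prod_continuous_toLp 2 _ _).measurable).lintegral_prod_right'

end Cylinder

/-! ### Functions vanishing on the lateral boundary of a cylinder -/

section Lateral

variable {m k : ℕ} {p : ℝ} {S : Set (EuclideanSpace ℝ (Fin m))}
  {T : Set (EuclideanSpace ℝ (Fin k))}

/-- `w ∈ W^{1,p}(S × T)`, with gradient `D`, vanishes on the lateral boundary `S × ∂T`: it is a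
limit in `W^{1,p}(S × T)` of smooth functions whose support lies over a compact subset of `T`.
Nothing is asked on `∂S × T`. -/
structure VanishesLaterally (S : Set (EuclideanSpace ℝ (Fin m)))
    (T : Set (EuclideanSpace ℝ (Fin k))) (p : ℝ) (w : CylSpace m k → ℝ)
    (D : CylSpace m k → CylSpace m k) : Prop where
  memLp : MemLp w (ENNReal.ofReal p) (volume.restrict (cyl S T))
  memLp_grad : MemLp D (ENNReal.ofReal p) (volume.restrict (cyl S T))
  approx : ∃ v : ℕ → CylSpace m k → ℝ, (∀ j, ContDiff ℝ ∞ (v j)) ∧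
    (∀ j, ∃ Q ⊆ T, IsCompact Q ∧ ∀ x : CylSpace m k, x.snd ∉ Q → v j x = 0) ∧
    (∀ j, MemLp (v j) (ENNReal.ofReal p) (volume.restrict (cyl S T))) ∧
    (∀ j, MemLp (gradient (v j)) (ENNReal.ofReal p) (volume.restrict (cyl S T))) ∧
    Tendsto (fun j => eLpNorm (fun x => w x - v j x) (ENNReal.ofReal p)
      (volume.restrict (cyl S T))) atTop (𝓝 0) ∧
    Tendsto (fun j => eLpNorm (fun x => D x - gradient (v j) x) (ENNReal.ofReal p)
      (volume.restrict (cyl S T))) atTop (𝓝 0)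

theorem MemSobolevZero.vanishesLaterally {u : CylSpace m k → ℝ} {g : CylSpace m k → CylSpace m k}
    (h : MemSobolevZero (cyl S T) p u g) : VanishesLaterally S T p u g where
  memLp := h.mem.memLp
  memLp_grad := h.mem.memLp_grad
  approx := by
    obtain ⟨φ, hφ, h1, h2⟩ := h.approx
    refine ⟨φ, fun j => (hφ j).smooth, fun j => ⟨(fun x : CylSpace m k => x.snd) '' tsupport (φ j),
      ?_, ?_, ?_⟩, fun j => (hφ j).memLp _ _, fun j => (hφ j).memLp_gradient _ _, h1, h2⟩
    · rintro _ ⟨x, hx, rfl⟩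
      exact ((hφ j).supp hx).2
    · exact (hφ j).compact.isCompact.image (WithLp.sndL 2 ℝ (EuclideanSpace ℝ (Fin m))
        (EuclideanSpace ℝ (Fin k))).continuous
    · exact fun x hx => image_eq_zero_of_notMem_tsupport fun hxs => hx ⟨x, hxs, rfl⟩

/-- A function of `W_0^{1,p}(T)`, extended constantly in `X₁`, vanishes on the lateral boundary. -/
theorem MemSobolevZero.vanishesLaterally_comp_snd (hp : 1 < p) (hS : MeasurableSet S)
    (hT : MeasurableSet T) (hfin : volume S ≠ ⊤) {v : EuclideanSpace ℝ (Fin k) → ℝ}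
    {h : EuclideanSpace ℝ (Fin k) → EuclideanSpace ℝ (Fin k)} (hv : MemSobolevZero T p v h) :
    VanishesLaterally S T p (fun x => v x.snd) (fun x => inrL m k (h x.snd)) := by
  have hp0 : 0 < p := by linarith
  have inr_memLp : ∀ {a : EuclideanSpace ℝ (Fin k) → EuclideanSpace ℝ (Fin k)},
      MemLp a (ENNReal.ofReal p) (volume.restrict T) →
      MemLp (fun x : CylSpace m k => inrL m k (a x.snd)) (ENNReal.ofReal p)
        (volume.restrict (cyl S T)) := fun {a} ha =>
    (inrL m k).comp_memLp' (memLp_comp_snd hS hT hfin hp0 ha)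
  obtain ⟨ψ, hψ, h1, h2⟩ := hv.approx
  have hgrad : ∀ j, gradient (fun x : CylSpace m k => ψ j x.snd) =
      fun x => inrL m k (gradient (ψ j) x.snd) :=
    fun j => funext fun x => gradient_comp_snd (hψ j).contDiff_one x
  -- the constant extension in `X₁` is continuous from `L^p(T)` to `L^p(S × T)`
  have key : ∀ {V : Type} [NormedAddCommGroup V] {a : ℕ → EuclideanSpace ℝ (Fin k) → V},
      (∀ j, AEStronglyMeasurable (a j) (volume.restrict T)) →
      Tendsto (fun j => eLpNorm (a j) (ENNReal.ofReal p) (volume.restrict T)) atTop (𝓝 0) →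
      Tendsto (fun j => eLpNorm (fun x : CylSpace m k => a j x.snd) (ENNReal.ofReal p)
        (volume.restrict (cyl S T))) atTop (𝓝 0) := by
    intro V _ a ha hlim
    refine Tendsto.congr (fun j => (eLpNorm_comp_snd hS hT hp0 (ha j)).symm) ?_
    have := ENNReal.Tendsto.const_mul hlim (a := volume S ^ (1 / p))
      (Or.inr (ENNReal.rpow_ne_top_of_nonneg (by positivity) hfin))
    rwa [mul_zero] at this
  refine ⟨memLp_comp_snd hS hT hfin hp0 hv.mem.memLp, inr_memLp hv.mem.memLp_grad,
    fun j x => ψ j x.snd, fun j => contDiff_comp_snd (hψ j).smooth,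
    fun j => ⟨tsupport (ψ j), (hψ j).supp, (hψ j).compact.isCompact,
      fun x hx => image_eq_zero_of_notMem_tsupport hx⟩,
    fun j => memLp_comp_snd hS hT hfin hp0 ((hψ j).memLp _ _), fun j => ?_, ?_, ?_⟩
  · rw [hgrad]
    exact inr_memLp ((hψ j).memLp_gradient _ _)
  · exact key (a := fun j y => v y - ψ j y) (fun j => hv.mem.memLp.1.sub
      ((hψ j).memLp (ENNReal.ofReal p) _).1) h1
  · have := key (a := fun j y => h y - gradient (ψ j) y) (fun j => hv.mem.memLp_grad.1.sub
      ((hψ j).memLp_gradient (ENNReal.ofReal p) _).1) h2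
    refine tendsto_eLpNorm_of_norm_le_mul 1 (fun j x => ?_) this
    rw [hgrad, ← map_sub, norm_inrL, one_mul]

namespace VanishesLaterally

variable {w w' : CylSpace m k → ℝ} {D D' : CylSpace m k → CylSpace m k}

theorem sub (hp : 1 < p) (h : VanishesLaterally S T p w D) (h' : VanishesLaterally S T p w' D') :
    VanishesLaterally S T p (fun x => w x - w' x) (fun x => D x - D' x) := by
  obtain ⟨v, hv, hQ, m1, m2, l1, l2⟩ := h.approx
  obtain ⟨v', hv', hQ', m1', m2', l1', l2'⟩ := h'.approx
  have one_le : 1 ≤ ENNReal.ofReal p := by simpa using hp.le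
  have hgrad : ∀ j, gradient (fun x => v j x - v' j x) =
      fun x => gradient (v j) x - gradient (v' j) x := fun j => funext fun x => by
    have d1 := (hv j).differentiable (by simp) x
    have d2 := (hv' j).differentiable (by simp) x
    simp only [gradient]
    rw [fderiv_fun_sub d1 d2, map_sub]
  refine ⟨h.memLp.sub h'.memLp, h.memLp_grad.sub h'.memLp_grad, fun j x => v j x - v' j x,
    fun j => (hv j).sub (hv' j), fun j => ?_, fun j => (m1 j).sub (m1' j), fun j => ?_, ?_, ?_⟩
  · obtain ⟨Q, hQT, hQc, hQ0⟩ := hQ j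
    obtain ⟨Q', hQT', hQc', hQ0'⟩ := hQ' j
    refine ⟨Q ∪ Q', union_subset hQT hQT', hQc.union hQc', fun x hx => ?_⟩
    change v j x - v' j x = 0
    rw [hQ0 x fun hm => hx (Or.inl hm), hQ0' x fun hm => hx (Or.inr hm), sub_zero]
  · rw [hgrad]
    exact (m2 j).sub (m2' j)
  · have l1n : Tendsto (fun j => eLpNorm (fun x => -(w' x - v' j x)) (ENNReal.ofReal p)
        (volume.restrict (cyl S T))) atTop (𝓝 0) :=
      tendsto_eLpNorm_of_norm_le_mul 1 (fun j x => by rw [norm_neg, one_mul]) l1'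
    have := tendsto_eLpNorm_add one_le (fun j => h.memLp.1.sub (m1 j).1)
      (fun j => (h'.memLp.1.sub (m1' j).1).neg) l1 l1n
    refine this.congr fun j => ?_
    congr 1
    ext x
    simp only [Pi.sub_apply, Pi.neg_apply]
    ring
  · have l2n : Tendsto (fun j => eLpNorm (fun x => -(D' x - gradient (v' j) x)) (ENNReal.ofReal p)
        (volume.restrict (cyl S T))) atTop (𝓝 0) :=
      tendsto_eLpNorm_of_norm_le_mul 1 (fun j x => by rw [norm_neg, one_mul]) l2'
    have := tendsto_eLpNorm_add one_le (fun j => h.memLp_grad.1.sub (m2 j).1)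
      (fun j => (h'.memLp_grad.1.sub (m2' j).1).neg) l2 l2n
    refine this.congr fun j => ?_
    congr 1
    ext x
    simp only [Pi.sub_apply, Pi.neg_apply, hgrad]
    abel

theorem hasWeakGradient (hp : 1 < p) (h : VanishesLaterally S T p w D) :
    HasWeakGradient (cyl S T) w D := by
  obtain ⟨v, hv, -, m1, m2, l1, l2⟩ := h.approx
  exact hasWeakGradient_of_tendsto hp h.memLp h.memLp_grad
    (fun j => (hv j).of_le (by exact_mod_cast le_top)) m1 m2 l1 l2

/-- Poincaré inequality for functions that vanish on the lateral boundary, with a weight that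
depends on `X₁` only. -/
theorem poincare {K : ℝ} (hS : MeasurableSet S) (hT : MeasurableSet T) (hp : 1 < p) (hK₀ : 0 ≤ K)
    (hK : ∀ φ : EuclideanSpace ℝ (Fin k) → ℝ, IsTestFunction T φ →
      ∫⁻ x in T, ‖φ x‖ₑ ^ p ≤ ENNReal.ofReal K * ∫⁻ x in T, ‖gradient φ x‖ₑ ^ p)
    {s : EuclideanSpace ℝ (Fin m) → ℝ} (hs : Continuous s) {B : ℝ} (hB : ∀ X, ‖s X‖ ≤ B)
    (h : VanishesLaterally S T p w D) :
    ∫ x in cyl S T, ‖s x.fst * w x‖ ^ p ≤ K * ∫ x in cyl S T, ‖s x.fst • D x‖ ^ p := by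
  have hp0 : 0 < p := by linarith
  obtain ⟨v, hv, hQ, m1, m2, l1, l2⟩ := h.approx
  have hsm : AEStronglyMeasurable (fun x : CylSpace m k => s x.fst)
      (volume.restrict (cyl S T)) :=
    (hs.measurable.comp measurable_cyl_fst).aestronglyMeasurable
  have e1 : MemLp (fun x => s x.fst * w x) (ENNReal.ofReal p) (volume.restrict (cyl S T)) :=
    h.memLp.of_le_mul (c := B) (hsm.mul h.memLp.1) (.of_forall fun x => by
      rw [norm_mul]; gcongr; exact hB _)
  have e2 : MemLp (fun x => s x.fst • D x) (ENNReal.ofReal p) (volume.restrict (cyl S T)) :=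
    h.memLp_grad.of_le_mul (c := B) (hsm.smul h.memLp_grad.1) (.of_forall fun x => by
      rw [norm_smul]; gcongr; exact hB _)
  have main : eLpNorm (fun x => s x.fst * w x) (ENNReal.ofReal p) (volume.restrict (cyl S T)) ≤
      ENNReal.ofReal K ^ (1 / p) *
        eLpNorm (fun x => s x.fst • D x) (ENNReal.ofReal p) (volume.restrict (cyl S T)) := by
    refine eLpNorm_le_mul_of_tendsto (aj := fun j x => s x.fst * v j x)
      (bj := fun j x => s x.fst • gradient (v j) x) (by simpa using hp.le)
      (ENNReal.rpow_ne_top_of_nonneg (by positivity) ENNReal.ofReal_ne_top) e1.1 e2.1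
      (fun j => hsm.mul (m1 j).1) (fun j => hsm.smul (m2 j).1) ?_ ?_ fun j => ?_
    · refine tendsto_eLpNorm_of_norm_le_mul B (fun j x => ?_) l1
      rw [← mul_sub, norm_mul]
      gcongr
      exact hB _
    · refine tendsto_eLpNorm_of_norm_le_mul B (fun j x => ?_) l2
      rw [← smul_sub, norm_smul]
      gcongr
      exact hB _
    · have hslice : ∀ X, IsTestFunction T fun Y => v j (WithLp.toLp 2 (X, Y)) := by
        intro X
        obtain ⟨Q, hQT, hQc, hQ0⟩ := hQ j
        have hsub : tsupport (fun Y => v j (WithLp.toLp 2 (X, Y))) ⊆ Q :=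
          closure_minimal (fun Y hY => by_contra fun hn => hY (hQ0 _ hn)) hQc.isClosed
        refine ⟨?_, hQc.of_isClosed_subset (isClosed_tsupport _) hsub, hsub.trans hQT⟩
        simp only [toLp_eq_inlL_add_inrL]
        exact (hv j).comp (contDiff_const.add (inrL m k).contDiff)
      have := lintegral_cyl_poincare hS hT hp0 hK hs
        ((hv j).of_le (by exact_mod_cast le_top)) hslice
      rw [← eLpNorm_ofReal_rpow hp0, ← eLpNorm_ofReal_rpow hp0] at this
      rw [← ENNReal.rpow_le_rpow_iff hp0, ENNReal.mul_rpow_of_nonneg _ _ hp0.le, one_div,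
        ENNReal.rpow_inv_rpow hp0.ne']
      exact this
  rw [← ENNReal.rpow_le_rpow_iff hp0, ENNReal.mul_rpow_of_nonneg _ _ hp0.le, one_div,
    ENNReal.rpow_inv_rpow hp0.ne', eLpNorm_ofReal_rpow hp0, eLpNorm_ofReal_rpow hp0,
    lintegral_enorm_rpow_eq_ofReal hp0 e1, lintegral_enorm_rpow_eq_ofReal hp0 e2,
    ← ENNReal.ofReal_mul hK₀] at main
  refine (ENNReal.ofReal_le_ofReal_iff ?_).1 main
  positivity

/-- A cut-off in the variable `X₁` makes a function that vanishes on the lateral boundary an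
element of `W_0^{1,p}(S × T)`. -/
theorem cutoff (hp : 1 < p) (h : VanishesLaterally S T p w D)
    {ρ : EuclideanSpace ℝ (Fin m) → ℝ} (hρ : IsTestFunction S ρ) :
    MemSobolevZero (cyl S T) p (fun x => ρ x.fst * w x)
      (fun x => ρ x.fst • D x + w x • inlL m k (gradient ρ x.fst)) := by
  obtain ⟨v, hv, hQ, m1, m2, l1, l2⟩ := h.approx
  have hρc := hρ.smooth.continuous
  have hgc := continuous_gradient hρ.contDiff_one
  obtain ⟨B, hB⟩ := hρ.compact.exists_bound_of_continuous hρc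
  obtain ⟨B', hB'⟩ := hρ.hasCompactSupport_gradient.exists_bound_of_continuous hgc
  have hρm : AEStronglyMeasurable (fun x : CylSpace m k => ρ x.fst) (volume.restrict (cyl S T)) :=
    (hρc.measurable.comp measurable_cyl_fst).aestronglyMeasurable
  have hgm : AEStronglyMeasurable (fun x : CylSpace m k => inlL m k (gradient ρ x.fst))
      (volume.restrict (cyl S T)) :=
    ((inlL m k).continuous.measurable.comp
      (hgc.measurable.comp measurable_cyl_fst)).aestronglyMeasurable
  have b1 : ∀ {V : Type} [NormedAddCommGroup V] [NormedSpace ℝ V] (x : CylSpace m k) (y : V),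
      ‖ρ x.fst • y‖ ≤ B * ‖y‖ := fun x y => by
    rw [norm_smul]; gcongr; exact hB _
  have b2 : ∀ (x : CylSpace m k) (y : ℝ),
      ‖y • inlL m k (gradient ρ x.fst)‖ ≤ B' * ‖y‖ := fun x y => by
    rw [norm_smul, norm_inlL, mul_comm]; gcongr; exact hB' _
  have one_le : 1 ≤ ENNReal.ofReal p := by simpa using hp.le
  have hgrad : ∀ j x, gradient (fun x : CylSpace m k => ρ x.fst * v j x) x =
      ρ x.fst • gradient (v j) x + v j x • inlL m k (gradient ρ x.fst) := by
    intro j x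
    rw [← gradient_comp_fst hρ.contDiff_one]
    simp only [gradient]
    rw [fderiv_fun_mul ((contDiff_comp_fst hρ.contDiff_one).differentiable one_ne_zero x)
      ((hv j).differentiable (by simp) x), map_add]
    simp
  refine memSobolevZero_of_tendsto (w := fun j x => ρ x.fst * v j x) hp
    (h.memLp.of_le_mul (c := B) (hρm.mul h.memLp.1) (.of_forall fun x => b1 x (w x)))
    ((h.memLp_grad.of_le_mul (c := B) (hρm.smul h.memLp_grad.1)
        (.of_forall fun x => b1 x (D x))).add
      (h.memLp.of_le_mul (c := B') (h.memLp.1.smul hgm) (.of_forall fun x => b2 x (w x))))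
    (fun j => ?_) ?_ ?_
  · obtain ⟨Q, hQT, hQc, hQ0⟩ := hQ j
    have hcomp : IsCompact (WithLp.toLp 2 '' (tsupport ρ ×ˢ Q) : Set (CylSpace m k)) :=
      (hρ.compact.isCompact.prod hQc).image (WithLp.prod_continuous_toLp 2 _ _)
    have hsub : tsupport (fun x : CylSpace m k => ρ x.fst * v j x) ⊆
        WithLp.toLp 2 '' (tsupport ρ ×ˢ Q) := by
      refine closure_minimal (fun x hx => ⟨x.ofLp, ⟨?_, ?_⟩, rfl⟩) hcomp.isClosed
      · refine subset_tsupport ρ fun h0 => hx ?_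
        change ρ x.fst = 0 at h0
        simp only [h0, zero_mul]
      · by_contra hn
        exact hx (by simp only [hQ0 x hn, mul_zero])
    refine ⟨(contDiff_comp_fst hρ.smooth).mul (hv j),
      hcomp.of_isClosed_subset (isClosed_tsupport _) hsub, hsub.trans ?_⟩
    rintro _ ⟨x, ⟨h1, h2⟩, rfl⟩
    exact ⟨hρ.supp h1, hQT h2⟩
  · refine tendsto_eLpNorm_of_norm_le_mul B (fun j x => ?_) l1
    rw [← mul_sub]
    exact b1 x _
  · have t1 : Tendsto (fun j => eLpNorm (fun x => ρ x.fst • (D x - gradient (v j) x))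
        (ENNReal.ofReal p) (volume.restrict (cyl S T))) atTop (𝓝 0) :=
      tendsto_eLpNorm_of_norm_le_mul B (fun j x => b1 x _) l2
    have t2 : Tendsto (fun j => eLpNorm (fun x => (w x - v j x) • inlL m k (gradient ρ x.fst))
        (ENNReal.ofReal p) (volume.restrict (cyl S T))) atTop (𝓝 0) :=
      tendsto_eLpNorm_of_norm_le_mul B' (fun j x => b2 x _) l1
    refine (tendsto_eLpNorm_add one_le (fun j => hρm.smul (h.memLp_grad.1.sub (m2 j).1))
      (fun j => (h.memLp.1.sub (m1 j).1).smul hgm) t1 t2).congr fun j => ?_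
    congr 1
    ext1 x
    simp only [hgrad, Pi.sub_apply, smul_sub, sub_smul, Pi.smul_apply']
    abel

end VanishesLaterally

/-- A weak equation on the cross-section `T` holds on the cylinder `S × T` as well, against every
element of `W_0^{1,p}(S × T)`. For a test function this is Fubini's theorem, as each of its slices
is a test function in `T`; the general case follows by density. -/
theorem integral_cyl_eq_of_cross_section (hp : 1 < p) (hS : MeasurableSet S)
    (hT : MeasurableSet T) (hfin : volume S ≠ ⊤)
    {a : EuclideanSpace ℝ (Fin k) → EuclideanSpace ℝ (Fin k)} {f : EuclideanSpace ℝ (Fin k) → ℝ}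
    (ha : MemLp a (ENNReal.ofReal (p / (p - 1))) (volume.restrict T))
    (hf : MemLp f (ENNReal.ofReal (p / (p - 1))) (volume.restrict T))
    (heq : ∀ φ : EuclideanSpace ℝ (Fin k) → ℝ, IsTestFunction T φ →
      ∫ y in T, ⟪a y, gradient φ y⟫_ℝ = ∫ y in T, f y * φ y)
    {φ : CylSpace m k → ℝ} {gφ : CylSpace m k → CylSpace m k}
    (hφ : MemSobolevZero (cyl S T) p φ gφ) :
    ∫ x in cyl S T, ⟪inrL m k (a x.snd), gφ x⟫_ℝ = ∫ x in cyl S T, f x.snd * φ x := by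
  have := holderTriple_ofReal hp
  have hq : 0 < p / (p - 1) := div_pos (by linarith) (by linarith)
  have ha' := (inrL m k).comp_memLp' (memLp_comp_snd hS hT hfin hq ha)
  have hf' := memLp_comp_snd hS hT hfin hq hf
  obtain ⟨v, hv, l1, l2⟩ := hφ.approx
  have t1 := tendsto_integral_bilin (innerSL ℝ) ha' hφ.mem.memLp_grad
    (fun j => (hv j).memLp_gradient _ _) l2
  have t2 := tendsto_integral_bilin (ContinuousLinearMap.mul ℝ ℝ) hf' hφ.mem.memLp
    (fun j => (hv j).memLp _ _) l1
  refine tendsto_nhds_unique t1 (t2.congr fun j => ?_)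
  have i1 := memLp_one_iff_integrable.1 (memLp_bilin (r := 1) (innerSL ℝ) ha'
    ((hv j).memLp_gradient (ENNReal.ofReal p) (volume.restrict (cyl S T))))
  have i2 := memLp_one_iff_integrable.1 (memLp_bilin (r := 1) (ContinuousLinearMap.mul ℝ ℝ) hf'
    ((hv j).memLp (ENNReal.ofReal p) (volume.restrict (cyl S T))))
  rw [integral_cyl hS hT i1, integral_cyl hS hT i2]
  refine integral_congr_ae (.of_forall fun X => ?_)
  have := heq _ ((hv j).slice X)
  simp only [gradient_slice (hv j).contDiff_one] at this
  change (∫ Y in T, f Y * v j (WithLp.toLp 2 (X, Y))) =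
    ∫ Y in T, ⟪inrL m k (a Y), gradient (v j) (WithLp.toLp 2 (X, Y))⟫_ℝ
  simp only [inner_inrL]
  exact this.symm

end Lateral

/-! ### Cut-off functions -/

section Cutoff

/-- Convexity puts the closure of `(1/2) Ω` inside `Ω`, which leaves room for a cut-off. -/
theorem exists_cutoff {E : Type*} [NormedAddCommGroup E] [InnerProductSpace ℝ E]
    [FiniteDimensional ℝ E] {Ω : Set E} (ho : IsOpen Ω) (hb : Bornology.IsBounded Ω)
    (hc : Convex ℝ Ω) (h0 : (0 : E) ∈ Ω) :
    ∃ ψ : E → ℝ, IsTestFunction Ω ψ ∧ (∀ x, 0 ≤ ψ x) ∧ ∀ x ∈ (1 / 2 : ℝ) • Ω, ψ x = 1 := by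
  have hsub : closure ((1 / 2 : ℝ) • Ω) ⊆ Ω := by
    rw [closure_smul₀]
    rintro _ ⟨x, hx, rfl⟩
    have := hc.combo_interior_closure_mem_interior (ho.interior_eq.symm ▸ h0) hx
      (a := 1 / 2) (b := 1 / 2) (by norm_num) (by norm_num) (by norm_num)
    rw [smul_zero, zero_add] at this
    exact interior_subset this
  have hcomp : IsCompact (closure ((1 / 2 : ℝ) • Ω)) := (hb.smul₀ _).isCompact_closure
  obtain ⟨L, hL, hL1, hL2⟩ := exists_compact_between hcomp ho hsub
  obtain ⟨ψ, hψ0, hψ1, hψ⟩ := exists_contMDiffMap_zero_one_of_isClosed (n := ⊤)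
    (modelWithCornersSelf ℝ E) (isOpen_interior (s := L)).isClosed_compl isClosed_closure
    (disjoint_compl_left_iff_subset.2 hL1)
  have hts : tsupport ψ ⊆ L := closure_minimal (fun x hx => by_contra fun hn =>
    hx (hψ0 fun hi => hn (interior_subset hi))) hL.isClosed
  exact ⟨ψ, ⟨ψ.contMDiff.contDiff, hL.of_isClosed_subset (isClosed_tsupport _) hts,
    hts.trans hL2⟩, fun x => (hψ x).1, fun x hx => hψ1 (subset_closure hx)⟩

/-- Cut-offs of `l Ω` that equal `l` on `(l/2) Ω`, with gradients bounded uniformly in `l`: they are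
`x ↦ l ψ(x / l)` for a fixed cut-off `ψ` of `Ω`. -/
theorem exists_scaled_cutoff {E : Type*} [NormedAddCommGroup E] [InnerProductSpace ℝ E]
    [FiniteDimensional ℝ E] {Ω : Set E} (ho : IsOpen Ω) (hb : Bornology.IsBounded Ω)
    (hc : Convex ℝ Ω) (h0 : (0 : E) ∈ Ω) :
    ∃ M : ℝ, 0 < M ∧ ∀ l : ℝ, 0 < l → ∃ ψ : E → ℝ, IsTestFunction (l • Ω) ψ ∧ (∀ x, 0 ≤ ψ x) ∧
      (∀ x, ‖gradient ψ x‖ ≤ M) ∧ ∀ x ∈ (l / 2) • Ω, ψ x = l := by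
  obtain ⟨ψ, hψ, hnn, h1⟩ := exists_cutoff ho hb hc h0
  obtain ⟨M, hM⟩ := hψ.hasCompactSupport_gradient.exists_bound_of_continuous
    (continuous_gradient hψ.contDiff_one)
  have hM0 : 0 ≤ M := (norm_nonneg _).trans (hM 0)
  refine ⟨M + 1, by linarith, fun l hl => ⟨fun x => l * ψ (l⁻¹ • x), ?_, ?_, ?_, ?_⟩⟩
  · have hcomp : IsCompact (l • tsupport ψ) := hψ.compact.isCompact.smul l
    have hsub : tsupport (fun x => l * ψ (l⁻¹ • x)) ⊆ l • tsupport ψ := by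
      refine closure_minimal (fun x hx => ?_) hcomp.isClosed
      rw [mem_smul_set_iff_inv_smul_mem₀ hl.ne']
      refine subset_tsupport ψ fun h => hx ?_
      simp only [h, mul_zero]
    exact ⟨contDiff_const.mul (hψ.smooth.comp (contDiff_const_smul _)),
      hcomp.of_isClosed_subset (isClosed_tsupport _) hsub,
      hsub.trans (smul_set_mono hψ.supp)⟩
  · exact fun x => mul_nonneg hl.le (hnn _)
  · intro x
    have hg : gradient (fun x => l * ψ (l⁻¹ • x)) x = gradient ψ (l⁻¹ • x) := by
      refine HasGradientAt.gradient ?_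
      rw [hasGradientAt_iff_hasFDerivAt]
      have d1 : HasFDerivAt (fun x : E => l⁻¹ • x) (l⁻¹ • ContinuousLinearMap.id ℝ E) x :=
        (hasFDerivAt_id x).const_smul l⁻¹
      have d2 : HasFDerivAt (fun x => ψ (l⁻¹ • x)) _ x :=
        (hψ.contDiff_one.differentiable one_ne_zero (l⁻¹ • x)).hasFDerivAt.comp x d1
      refine (d2.const_mul l).congr_fderiv ?_
      ext y
      simp [hl.ne']
    rw [hg]
    linarith [hM (l⁻¹ • x)]
  · intro x hx
    change l * ψ (l⁻¹ • x) = l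
    rw [h1, mul_one]
    rw [mem_smul_set_iff_inv_smul_mem₀ (by positivity)] at hx ⊢
    rw [smul_smul]
    convert hx using 2
    field_simp

end Cutoff

/-! ### Energy estimates -/

section Energy

/-- Coercivity and growth of order `p - 1` bound the distance of `g` to `g'` by the `p`-energy of
`g'`, if the fluxes of `g` and `g'` have the same pairing with `g`. -/
theorem exists_energy_bound {α V : Type*} [MeasurableSpace α] [NormedAddCommGroup V]
    [InnerProductSpace ℝ V] {A : V → V} {p c Λ : ℝ} (hp : 1 < p) (hc : 0 < c) (hΛ : 0 < Λ)
    (hcoer : ∀ z, c * ‖z‖ ^ p ≤ ⟪A z, z⟫_ℝ) (hgrow : ∀ z, ‖A z‖ ≤ Λ * ‖z‖ ^ (p - 1)) :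
    ∃ M : ℝ, 0 < M ∧ ∀ (μ : Measure α) (g g' : α → V),
      MemLp g (ENNReal.ofReal p) μ → MemLp g' (ENNReal.ofReal p) μ →
      MemLp (fun x => A (g x)) (ENNReal.ofReal (p / (p - 1))) μ →
      MemLp (fun x => A (g' x)) (ENNReal.ofReal (p / (p - 1))) μ →
      ∫ x, ⟪A (g x), g x⟫_ℝ ∂μ = ∫ x, ⟪A (g' x), g x⟫_ℝ ∂μ →
      ∫ x, ‖g x - g' x‖ ^ p ∂μ ≤ M * ∫ x, ‖g' x‖ ^ p ∂μ := by
  have hp0 : 0 < p := by linarith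
  obtain ⟨N, hN, hyoung⟩ := exists_young hp (ε := c / (2 * Λ)) (by positivity)
  refine ⟨2 ^ p * (2 * Λ * N / c + 1), by positivity, ?_⟩
  intro μ g g' hg hg' hAg hAg' heq
  have := holderTriple_ofReal hp
  have i1 := integrable_norm_rpow_ofReal hp0 hg
  have i1' := integrable_norm_rpow_ofReal hp0 hg'
  have i2 := memLp_one_iff_integrable.1 (memLp_bilin (r := 1) (innerSL ℝ) hAg hg)
  have i2' := memLp_one_iff_integrable.1 (memLp_bilin (r := 1) (innerSL ℝ) hAg' hg)
  have l1 : c * ∫ x, ‖g x‖ ^ p ∂μ ≤ ∫ x, ⟪A (g x), g x⟫_ℝ ∂μ := by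
    rw [← integral_const_mul]
    exact integral_mono (i1.const_mul c) i2 fun x => hcoer (g x)
  have l2 : ∫ x, ⟪A (g' x), g x⟫_ℝ ∂μ ≤
      Λ * N * ∫ x, ‖g' x‖ ^ p ∂μ + c / 2 * ∫ x, ‖g x‖ ^ p ∂μ := by
    rw [← integral_const_mul, ← integral_const_mul,
      ← integral_add (i1'.const_mul _) (i1.const_mul _)]
    refine integral_mono i2' ((i1'.const_mul _).add (i1.const_mul _)) fun x => ?_
    calc ⟪A (g' x), g x⟫_ℝ ≤ ‖A (g' x)‖ * ‖g x‖ := real_inner_le_norm _ _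
      _ ≤ Λ * ‖g' x‖ ^ (p - 1) * ‖g x‖ := by gcongr; exact hgrow _
      _ = Λ * (‖g' x‖ ^ (p - 1) * ‖g x‖) := mul_assoc _ _ _
      _ ≤ Λ * (N * ‖g' x‖ ^ p + c / (2 * Λ) * ‖g x‖ ^ p) := by
          gcongr
          exact hyoung _ _ (norm_nonneg _) (norm_nonneg _)
      _ = Λ * N * ‖g' x‖ ^ p + c / 2 * ‖g x‖ ^ p := by field_simp
  have l3 : ∫ x, ‖g x‖ ^ p ∂μ ≤ 2 * Λ * N / c * ∫ x, ‖g' x‖ ^ p ∂μ := by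
    rw [div_mul_eq_mul_div, le_div_iff₀ hc]
    linarith
  calc ∫ x, ‖g x - g' x‖ ^ p ∂μ ≤ ∫ x, 2 ^ p * (‖g x‖ ^ p + ‖g' x‖ ^ p) ∂μ := by
        refine integral_mono (integrable_norm_rpow_ofReal hp0 (hg.sub hg'))
          ((i1.add i1').const_mul _) fun x => ?_
        refine le_trans ?_ (add_rpow_le_two_rpow_mul hp0.le (norm_nonneg _) (norm_nonneg _))
        beta_reduce
        gcongr
        exact norm_sub_le _ _
    _ = 2 ^ p * (∫ x, ‖g x‖ ^ p ∂μ + ∫ x, ‖g' x‖ ^ p ∂μ) := by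
        rw [integral_const_mul, integral_add i1 i1']
    _ ≤ 2 ^ p * (2 * Λ * N / c * ∫ x, ‖g' x‖ ^ p ∂μ + ∫ x, ‖g' x‖ ^ p ∂μ) := by gcongr
    _ = _ := by ring

/-- The pointwise inequality behind the weighted estimate: `z` and `z'` are the two gradients,
`t` is the value of the difference of the solutions, `η` the weight and `(a η) ξ` its gradient. -/
theorem inner_flux_sub_ge {m k : ℕ} {A : CylSpace m k → CylSpace m k} {p c Λ M a : ℝ}
    (hp : 1 < p) (hΛ : 0 < Λ) (ha : 0 < a)
    (hmono : ∀ z z', c * ‖z - z'‖ ^ p ≤ ⟪A z - A z', z - z'⟫_ℝ)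
    (hfst : ∀ z, ‖(A z).fst‖ ≤ Λ * ‖z.fst‖ ^ (p - 1))
    {z z' : CylSpace m k} (hz' : z'.fst = 0) {η t : ℝ} (hη : 1 ≤ η)
    {ξ : EuclideanSpace ℝ (Fin m)} (hξ : ‖ξ‖ ≤ M) :
    c * (η * ‖z - z'‖ ^ p - ‖z - z'‖ ^ p) - Λ * a * M * (η * ‖t‖ ^ p + η * ‖z - z'‖ ^ p) ≤
      ⟪A z, (η - 1) • (z - z') + t • inlL m k ((a * η) • ξ)⟫_ℝ -
        ⟪A z', (η - 1) • (z - z') + t • inlL m k ((a * η) • ξ)⟫_ℝ := by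
  have hM : 0 ≤ M := (norm_nonneg _).trans hξ
  have hη₀ : 0 ≤ η := by linarith
  have hfst0 : (A z').fst = 0 := by
    have := hfst z'
    rw [hz', norm_zero, Real.zero_rpow (by linarith), mul_zero] at this
    exact norm_le_zero_iff.1 this
  have hD : ‖z.fst‖ ≤ ‖z - z'‖ := by
    have := CylSpace.norm_fst_le (z - z')
    rwa [WithLp.sub_fst, hz', sub_zero] at this
  have hy := rpow_sub_one_mul_le hp (norm_nonneg (z - z')) (norm_nonneg t) one_pos
  rw [one_mul, Real.one_rpow, one_mul] at hy
  have b1 : (η - 1) * (c * ‖z - z'‖ ^ p) ≤ (η - 1) * ⟪A z - A z', z - z'⟫_ℝ :=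
    mul_le_mul_of_nonneg_left (hmono _ _) (by linarith)
  have b2 : |t * ⟪(A z).fst, (a * η) • ξ⟫_ℝ| ≤
      Λ * a * M * (η * ‖t‖ ^ p + η * ‖z - z'‖ ^ p) := by
    calc |t * ⟪(A z).fst, (a * η) • ξ⟫_ℝ|
        ≤ ‖t‖ * (‖(A z).fst‖ * ‖(a * η) • ξ‖) := by
          rw [abs_mul]
          exact mul_le_mul_of_nonneg_left (abs_real_inner_le_norm _ _) (abs_nonneg t)
      _ = ‖t‖ * (‖(A z).fst‖ * (a * η * ‖ξ‖)) := by
          rw [norm_smul, Real.norm_of_nonneg (mul_nonneg ha.le hη₀)]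
      _ ≤ ‖t‖ * ((Λ * ‖z - z'‖ ^ (p - 1)) * (a * η * M)) := by
          gcongr
          refine (hfst z).trans ?_
          gcongr
      _ = Λ * a * M * η * (‖z - z'‖ ^ (p - 1) * ‖t‖) := by ring
      _ ≤ Λ * a * M * η * (‖z - z'‖ ^ p + ‖t‖ ^ p) := by gcongr
      _ = _ := by ring
  have b3 : ⟪A z, (η - 1) • (z - z') + t • inlL m k ((a * η) • ξ)⟫_ℝ -
        ⟪A z', (η - 1) • (z - z') + t • inlL m k ((a * η) • ξ)⟫_ℝ =
      (η - 1) * ⟪A z - A z', z - z'⟫_ℝ + t * ⟪(A z).fst, (a * η) • ξ⟫_ℝ := by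
    rw [← inner_sub_left, inner_add_right, inner_smul_right _ _ (η - 1), inner_smul_right _ _ t,
      real_inner_comm (inlL m k _), inner_inlL, WithLp.sub_fst, hfst0, sub_zero,
      real_inner_comm (A z).fst]
  have b4 := neg_le_of_abs_le b2
  rw [b3]
  linarith

variable {m k : ℕ} {p : ℝ} {S : Set (EuclideanSpace ℝ (Fin m))}
  {T : Set (EuclideanSpace ℝ (Fin k))}

/-- The weighted estimate behind the exponential decay. The flux difference is tested with
`(exp (α ψ(X₁)) - 1) w`. Its part in the direction of `X₁` is controlled by the gradient of `w`
alone, so that after Poincaré's inequality the term with `∇ψ` is absorbed when `α` is small. -/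
theorem integral_exp_mul_le {A : CylSpace m k → CylSpace m k} {c Λ K M a : ℝ} (hp : 1 < p)
    (hc : 0 < c) (hΛ : 0 < Λ) (hK₀ : 0 < K) (ha : 0 < a)
    (hsmall : Λ * a * M * (K + 1) ≤ c / 2)
    (hS : MeasurableSet S) (hT : MeasurableSet T)
    (hmono : ∀ z z', c * ‖z - z'‖ ^ p ≤ ⟪A z - A z', z - z'⟫_ℝ)
    (hfst : ∀ z, ‖(A z).fst‖ ≤ Λ * ‖z.fst‖ ^ (p - 1))
    (hK : ∀ φ : EuclideanSpace ℝ (Fin k) → ℝ, IsTestFunction T φ →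
      ∫⁻ x in T, ‖φ x‖ₑ ^ p ≤ ENNReal.ofReal K * ∫⁻ x in T, ‖gradient φ x‖ₑ ^ p)
    {ψ : EuclideanSpace ℝ (Fin m) → ℝ} (hψ : IsTestFunction S ψ) (hψ₀ : ∀ X, 0 ≤ ψ X)
    (hψM : ∀ X, ‖gradient ψ X‖ ≤ M)
    {w : CylSpace m k → ℝ} {g g' : CylSpace m k → CylSpace m k}
    (hw : VanishesLaterally S T p w fun x => g x - g' x)
    (hg' : ∀ x, (g' x).fst = 0)
    (hAg : MemLp (fun x => A (g x)) (ENNReal.ofReal (p / (p - 1))) (volume.restrict (cyl S T)))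
    (hAg' : MemLp (fun x => A (g' x)) (ENNReal.ofReal (p / (p - 1))) (volume.restrict (cyl S T)))
    (heq : ∀ φ gφ, MemSobolevZero (cyl S T) p φ gφ →
      ∫ x in cyl S T, ⟪A (g x), gφ x⟫_ℝ = ∫ x in cyl S T, ⟪A (g' x), gφ x⟫_ℝ) :
    Integrable (fun x => Real.exp (a * ψ x.fst) * ‖g x - g' x‖ ^ p)
      (volume.restrict (cyl S T)) ∧
    ∫ x in cyl S T, Real.exp (a * ψ x.fst) * ‖g x - g' x‖ ^ p ≤
      2 * ∫ x in cyl S T, ‖g x - g' x‖ ^ p := by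
  have hp0 : 0 < p := by linarith
  have := holderTriple_ofReal hp
  set μ := (volume : Measure (CylSpace m k)).restrict (cyl S T) with hμ
  -- `ρ` is the cut-off factor of the test function `ρ w`
  set ρ : EuclideanSpace ℝ (Fin m) → ℝ := fun X => Real.exp (a * ψ X) - 1 with hρdef
  have hρ : IsTestFunction S ρ := by
    have hsub : tsupport ρ ⊆ tsupport ψ := closure_mono fun x hx h0 => hx (by simp [hρdef, h0])
    exact ⟨(contDiff_const.mul hψ.smooth).exp.sub contDiff_const,
      hψ.compact.isCompact.of_isClosed_subset (isClosed_tsupport _) hsub, hsub.trans hψ.supp⟩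
  have hρgrad : ∀ X, gradient ρ X = (a * Real.exp (a * ψ X)) • gradient ψ X := by
    intro X
    refine HasGradientAt.gradient ?_
    rw [hasGradientAt_iff_hasFDerivAt]
    have d := (hψ.contDiff_one.differentiable one_ne_zero X).hasFDerivAt
    refine ((d.const_mul a).exp.sub_const (1 : ℝ)).congr_fderiv ?_
    ext y
    simp
    ring
  have hρ₀ : ∀ X, 0 ≤ ρ X := fun X => sub_nonneg.2 (Real.one_le_exp (mul_nonneg ha.le (hψ₀ X)))
  -- Poincaré's inequality carries its weight inside the norm: `s ^ p = exp (a ψ)`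
  set s : EuclideanSpace ℝ (Fin m) → ℝ := fun X => Real.exp (a * ψ X / p) with hsdef
  have hsc : Continuous s :=
    Real.continuous_exp.comp ((continuous_const.mul hψ.smooth.continuous).div_const p)
  obtain ⟨B, hB⟩ : ∃ B, ∀ X, ‖s X‖ ≤ B := by
    obtain ⟨B, hB⟩ := hψ.compact.exists_bound_of_continuous hψ.smooth.continuous
    refine ⟨Real.exp (a * B / p), fun X => ?_⟩
    rw [hsdef, Real.norm_of_nonneg (Real.exp_pos _).le]
    gcongr
    exact (le_abs_self _).trans (hB X)
  have hsp : ∀ X, s X ^ p = Real.exp (a * ψ X) := fun X => by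
    rw [hsdef, ← Real.exp_mul, div_mul_cancel₀ _ hp0.ne']
  have hsm : AEStronglyMeasurable (fun x : CylSpace m k => s x.fst) μ :=
    (hsc.measurable.comp measurable_cyl_fst).aestronglyMeasurable
  have e1 : ∀ x, ‖s x.fst * w x‖ ^ p = Real.exp (a * ψ x.fst) * ‖w x‖ ^ p := fun x => by
    rw [norm_mul, Real.mul_rpow (norm_nonneg _) (norm_nonneg _),
      Real.norm_of_nonneg (Real.exp_pos _).le, ← hsp]
  have e2 : ∀ x, ‖s x.fst • (g x - g' x)‖ ^ p = Real.exp (a * ψ x.fst) * ‖g x - g' x‖ ^ p :=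
    fun x => by
      rw [norm_smul, Real.mul_rpow (norm_nonneg _) (norm_nonneg _),
        Real.norm_of_nonneg (Real.exp_pos _).le, ← hsp]
  have j1 : Integrable (fun x => Real.exp (a * ψ x.fst) * ‖w x‖ ^ p) μ := by
    simp only [← e1]
    exact integrable_norm_rpow_ofReal hp0 (hw.memLp.of_le_mul (c := B) (hsm.mul hw.memLp.1)
      (.of_forall fun x => by rw [norm_mul]; gcongr; exact hB _))
  have j2 : Integrable (fun x => Real.exp (a * ψ x.fst) * ‖g x - g' x‖ ^ p) μ := by
    simp only [← e2]
    exact integrable_norm_rpow_ofReal hp0 (hw.memLp_grad.of_le_mul (c := B)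
      (hsm.smul hw.memLp_grad.1) (.of_forall fun x => by rw [norm_smul]; gcongr; exact hB _))
  have j3 : Integrable (fun x => ‖g x - g' x‖ ^ p) μ :=
    integrable_norm_rpow_ofReal hp0 hw.memLp_grad
  refine ⟨j2, ?_⟩
  have hpoin := hw.poincare hS hT hp hK₀.le hK hsc hB
  simp only [e1, e2] at hpoin
  -- both weak equations are tested with `ρ w`, whose gradient is `gφ`
  have htest := hw.cutoff hp hρ
  set gφ : CylSpace m k → CylSpace m k :=
    fun x => ρ x.fst • (g x - g' x) + w x • inlL m k (gradient ρ x.fst) with hgφ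
  have h0 : ∫ x, ⟪A (g x), gφ x⟫_ℝ ∂μ = ∫ x, ⟪A (g' x), gφ x⟫_ℝ ∂μ := heq _ _ htest
  have i1 : Integrable (fun x => ⟪A (g x), gφ x⟫_ℝ) μ :=
    memLp_one_iff_integrable.1 (memLp_bilin (r := 1) (innerSL ℝ) hAg htest.mem.memLp_grad)
  have i2 : Integrable (fun x => ⟪A (g' x), gφ x⟫_ℝ) μ :=
    memLp_one_iff_integrable.1 (memLp_bilin (r := 1) (innerSL ℝ) hAg' htest.mem.memLp_grad)
  have hpt : ∀ x, c * ((Real.exp (a * ψ x.fst) * ‖g x - g' x‖ ^ p) - ‖g x - g' x‖ ^ p) -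
      Λ * a * M * (Real.exp (a * ψ x.fst) * ‖w x‖ ^ p +
        Real.exp (a * ψ x.fst) * ‖g x - g' x‖ ^ p) ≤
      ⟪A (g x), gφ x⟫_ℝ - ⟪A (g' x), gφ x⟫_ℝ := by
    intro x
    have := inner_flux_sub_ge hp hΛ ha hmono hfst (hg' x) (sub_nonneg.1 (hρ₀ x.fst)) (hψM x.fst)
      (z := g x) (t := w x)
    rwa [← hρgrad] at this
  have hint := integral_mono (((j2.sub j3).const_mul c).sub ((j1.add j2).const_mul (Λ * a * M)))
    (i1.sub i2) hpt
  have e3 := integral_sub ((j2.sub j3).const_mul c) ((j1.add j2).const_mul (Λ * a * M))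
  simp only [Pi.sub_apply, Pi.add_apply] at hint e3
  rw [integral_sub i1 i2, h0, sub_self, e3, integral_const_mul, integral_const_mul,
    integral_sub j2 j3, integral_add j1 j2] at hint
  set I := ∫ x, Real.exp (a * ψ x.fst) * ‖g x - g' x‖ ^ p ∂μ with hI
  have hI0 : 0 ≤ I := integral_nonneg fun x => by positivity
  have hM : 0 ≤ M := (norm_nonneg _).trans (hψM 0)
  have c1 : Λ * a * M * (∫ x, Real.exp (a * ψ x.fst) * ‖w x‖ ^ p ∂μ + I) ≤ c / 2 * I := by
    calc Λ * a * M * (∫ x, Real.exp (a * ψ x.fst) * ‖w x‖ ^ p ∂μ + I)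
        ≤ Λ * a * M * (K * I + I) := by gcongr
      _ = Λ * a * M * (K + 1) * I := by ring
      _ ≤ c / 2 * I := by gcongr
  have c2 : c * I ≤ c * (2 * ∫ x, ‖g x - g' x‖ ^ p ∂μ) := by linarith
  exact le_of_mul_le_mul_left c2 hc

end Energy

/-! ### Exponential decay -/

section Decay

/-- The flux of `H` is strongly monotone of order `p` on the product space. -/
theorem splitFlux_mono {m k : ℕ} {p c₁ θ₁ θ₂ : ℝ} {F : EuclideanSpace ℝ (Fin m) → ℝ}
    {G : EuclideanSpace ℝ (Fin k) → ℝ} (hp : 0 ≤ p) (hc₁ : 0 < c₁)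
    (hF : IsMonotoneComparable p c₁ θ₁ θ₂ F) (hG : IsMonotoneComparable p c₁ θ₁ θ₂ G)
    {A : CylSpace m k → CylSpace m k}
    (hA : ∀ z, A z = WithLp.toLp 2 (finslerFlux p F z.fst, finslerFlux p G z.snd))
    (z z' : CylSpace m k) : c₁ / 2 ^ p * ‖z - z'‖ ^ p ≤ ⟪A z - A z', z - z'⟫_ℝ := by
  have h1 := hF.mono z.fst z'.fst
  have h2 := hG.mono z.snd z'.snd
  have h3 : ⟪A z - A z', z - z'⟫_ℝ =
      ⟪finslerFlux p F z.fst - finslerFlux p F z'.fst, z.fst - z'.fst⟫_ℝ +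
        ⟪finslerFlux p G z.snd - finslerFlux p G z'.snd, z.snd - z'.snd⟫_ℝ := by
    rw [hA, hA, WithLp.prod_inner_apply]
    rfl
  rw [h3]
  calc c₁ / 2 ^ p * ‖z - z'‖ ^ p
      ≤ c₁ / 2 ^ p * (‖z.fst - z'.fst‖ + ‖z.snd - z'.snd‖) ^ p := by
        gcongr
        exact CylSpace.norm_le_fst_add_snd (z - z')
    _ ≤ c₁ / 2 ^ p * (2 ^ p * (‖z.fst - z'.fst‖ ^ p + ‖z.snd - z'.snd‖ ^ p)) := by
        gcongr
        exact add_rpow_le_two_rpow_mul hp (norm_nonneg _) (norm_nonneg _)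
    _ = c₁ * ‖z.fst - z'.fst‖ ^ p + c₁ * ‖z.snd - z'.snd‖ ^ p := by field_simp
    _ ≤ _ := add_le_add h1 h2

/-- The energy of the extended cross-section solution is proportional to the measure of the base. -/
theorem integral_norm_rpow_comp_snd {m k : ℕ} {p : ℝ} (hp : 0 < p)
    {S : Set (EuclideanSpace ℝ (Fin m))} {T : Set (EuclideanSpace ℝ (Fin k))}
    (hS : MeasurableSet S) (hT : MeasurableSet T) (hfin : volume S ≠ ⊤)
    {h : EuclideanSpace ℝ (Fin k) → EuclideanSpace ℝ (Fin k)}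
    (hh : MemLp h (ENNReal.ofReal p) (volume.restrict T)) :
    ∫ x in cyl S T, ‖inrL m k (h x.snd)‖ ^ p =
      (volume S).toReal * ∫ y in T, ‖h y‖ ^ p := by
  simp only [norm_inrL]
  rw [integral_cyl hS hT (integrable_norm_rpow_ofReal hp (memLp_comp_snd hS hT hfin hp hh))]
  simp [Measure.real]

/-- A bound on the energy with exponential weight bounds the `L^p` norm on the inner cylinder, where
the weight is `exp (a l)`. -/
theorem eLpNorm_le_of_integral_exp_mul_le {m k : ℕ} {p a l E : ℝ} (hp : 0 < p)
    {S S' : Set (EuclideanSpace ℝ (Fin m))} {T : Set (EuclideanSpace ℝ (Fin k))}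
    (hS' : MeasurableSet S') (hT : MeasurableSet T)
    (hsub : S' ⊆ S) {ψ : EuclideanSpace ℝ (Fin m) → ℝ} (hψ : ∀ X ∈ S', ψ X = l)
    {D : CylSpace m k → CylSpace m k}
    (hD : MemLp D (ENNReal.ofReal p) (volume.restrict (cyl S T)))
    (hi : Integrable (fun x => Real.exp (a * ψ x.fst) * ‖D x‖ ^ p) (volume.restrict (cyl S T)))
    (hE : ∫ x in cyl S T, Real.exp (a * ψ x.fst) * ‖D x‖ ^ p ≤ E) :
    eLpNorm D (ENNReal.ofReal p) (volume.restrict (cyl S' T)) ≤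
      ENNReal.ofReal ((E * Real.exp (-(a * l))) ^ (1 / p)) := by
  have hms : MeasurableSet (cyl S' T) :=
    (measurable_cyl_fst hS').inter (measurable_cyl_snd hT)
  have hcs : cyl S' T ⊆ cyl S T := cyl_mono hsub
  have hD' : MemLp D (ENNReal.ofReal p) (volume.restrict (cyl S' T)) :=
    hD.mono_measure (Measure.restrict_mono hcs le_rfl)
  have h1 : Real.exp (a * l) * ∫ x in cyl S' T, ‖D x‖ ^ p ≤ E := by
    rw [← integral_const_mul]
    calc ∫ x in cyl S' T, Real.exp (a * l) * ‖D x‖ ^ p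
        = ∫ x in cyl S' T, Real.exp (a * ψ x.fst) * ‖D x‖ ^ p :=
          setIntegral_congr_fun hms fun x hx => by simp only [hψ _ hx.1]
      _ ≤ ∫ x in cyl S T, Real.exp (a * ψ x.fst) * ‖D x‖ ^ p :=
          setIntegral_mono_set hi (.of_forall fun x => by positivity) hcs.eventuallyLE
      _ ≤ E := hE
  have h2 : ∫ x in cyl S' T, ‖D x‖ ^ p ≤ E * Real.exp (-(a * l)) := by
    rw [Real.exp_neg, ← div_eq_mul_inv, le_div_iff₀ (Real.exp_pos _), mul_comm]
    exact h1
  have h0 : 0 ≤ ∫ x in cyl S' T, ‖D x‖ ^ p := integral_nonneg fun x => by positivity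
  rw [← ENNReal.rpow_le_rpow_iff hp, eLpNorm_ofReal_rpow hp, lintegral_enorm_rpow_eq_ofReal hp hD',
    ENNReal.ofReal_rpow_of_nonneg (Real.rpow_nonneg (h0.trans h2) _) hp.le, one_div,
    Real.rpow_inv_rpow (h0.trans h2) hp.ne']
  exact ENNReal.ofReal_le_ofReal h2

end Decay

end

theorem theorem2 (m k : ℕ) (hm : 1 ≤ m) (hk : 1 ≤ k) (p : ℝ) (hp : 2 ≤ p)
    (ω₁ : Set (EuclideanSpace ℝ (Fin m))) (hω₁_open : IsOpen ω₁)
    (hω₁_bdd : Bornology.IsBounded ω₁) (hω₁_conv : Convex ℝ ω₁) (hω₁_zero : 0 ∈ ω₁)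
    (ω₂ : Set (EuclideanSpace ℝ (Fin k))) (hω₂_open : IsOpen ω₂)
    (hω₂_bdd : Bornology.IsBounded ω₂)
    (F : EuclideanSpace ℝ (Fin m) → ℝ) (G : EuclideanSpace ℝ (Fin k) → ℝ)
    (hH : IsFinsler (splitFinsler p F G))
    (c₁ θ₁ θ₂ : ℝ) (hc₁ : 0 < c₁) (hθ₁ : 0 < θ₁)
    (hF : IsMonotoneComparable p c₁ θ₁ θ₂ F) (hG : IsMonotoneComparable p c₁ θ₁ θ₂ G)
    (f : EuclideanSpace ℝ (Fin k) → ℝ)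
    (hf : MemLp f (ENNReal.ofReal (p / (p - 1))) (volume.restrict ω₂))
    (uInf : EuclideanSpace ℝ (Fin k) → ℝ)
    (huInf : IsWeakSolution ω₂ p (crossFlux p (splitFinsler p F G)) f uInf) :
    ∃ C β : ℝ, 0 < C ∧ 0 < β ∧ ∀ ℓ : ℝ, 0 < ℓ → ∀ u : CylSpace m k → ℝ,
      IsWeakSolution (cylDomain ω₁ ω₂ ℓ) p (finslerFlux p (splitFinsler p F G))
        (fun x => f x.snd) u →
      ∃ D : CylSpace m k → CylSpace m k,
        HasWeakGradient (cylDomain ω₁ ω₂ ℓ) (fun x => u x - uInf x.snd) D ∧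
        eLpNorm D (ENNReal.ofReal p) (volume.restrict (cylDomain ω₁ ω₂ (ℓ / 2))) ≤
          ENNReal.ofReal (C * Real.exp (-β * ℓ)) := by
  have hp1 : 1 < p := by linarith
  have hp0 : 0 < p := by linarith
  have : Nonempty (Fin m) := ⟨⟨0, hm⟩⟩
  have : Nonempty (Fin k) := ⟨⟨0, hk⟩⟩
  have hθ₂ : 0 < θ₂ := by
    obtain ⟨e, he⟩ := exists_norm_eq (EuclideanSpace ℝ (Fin m)) zero_le_one
    have h1 := hF.lower e
    have h2 := hF.upper e
    rw [he] at h1 h2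
    linarith
  have nonneg_F : ∀ z, 0 ≤ F z := fun z =>
    (mul_nonneg hθ₁.le (norm_nonneg z)).trans (hF.lower z)
  have nonneg_G : ∀ z, 0 ≤ G z := fun z =>
    (mul_nonneg hθ₁.le (norm_nonneg z)).trans (hG.lower z)
  have hF0 : F 0 = 0 := le_antisymm (by simpa using hF.upper 0) (nonneg_F 0)
  have hG0 : G 0 = 0 := le_antisymm (by simpa using hG.upper 0) (nonneg_G 0)
  -- `F` and `G` are the restrictions of `H` to the factors, hence Finsler functions themselves
  have hFf : IsFinsler F := hH.of_split_fst hp0 nonneg_F hG0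
  have hGf : IsFinsler G := hH.of_split_snd hp0 hF0 nonneg_G
  set A := finslerFlux p (splitFinsler p F G) with hAdef
  have hA : ∀ z, A z = WithLp.toLp 2 (finslerFlux p F z.fst, finslerFlux p G z.snd) :=
    finslerFlux_splitFinsler hp1 hθ₂.le hH hFf hGf hF.upper hG.upper
  have hAinr : ∀ y, A (inrL m k y) = inrL m k (finslerFlux p G y) := fun y => by
    rw [hA, inrL_fst, inrL_snd, hFf.finslerFlux_zero hp1, inrL_eq]
  have hcross : ∀ y, crossFlux p (splitFinsler p F G) y = finslerFlux p G y := fun y => by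
    rw [crossFlux, ← inrL_eq, ← hAdef, hAinr, inrL_snd]
  have hAgrow : ∀ z, ‖A z‖ ≤ (2 * θ₂) ^ p * ‖z‖ ^ (p - 1) :=
    hH.norm_finslerFlux_le hp1 (by positivity)
      (splitFinsler_le hp1.le hθ₂.le nonneg_F nonneg_G hF.upper hG.upper)
  have hAfst : ∀ z, ‖(A z).fst‖ ≤ θ₂ ^ p * ‖z.fst‖ ^ (p - 1) := fun z => by
    rw [hA]
    exact hFf.norm_finslerFlux_le hp1 hθ₂.le hF.upper _
  have hAmeas : Measurable A := measurable_finslerFlux (hH.lipschitzWith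
    (splitFinsler_le hp1.le hθ₂.le nonneg_F nonneg_G hF.upper hG.upper)).continuous.measurable
  set c := c₁ / 2 ^ p with hcdef
  have hc : 0 < c := by positivity
  have hmono := splitFlux_mono hp0.le hc₁ hF hG hA
  have hcoer : ∀ z, c * ‖z‖ ^ p ≤ ⟪A z, z⟫_ℝ := fun z => by
    have := hmono z 0
    rwa [sub_zero, show A 0 = 0 from hH.finslerFlux_zero hp1, sub_zero] at this
  -- `h` is the gradient of `uInf`
  obtain ⟨h, hh, heqInf⟩ := huInf
  have hGflux : MemLp (fun y => finslerFlux p G (h y)) (ENNReal.ofReal (p / (p - 1)))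
      (volume.restrict ω₂) :=
    memLp_of_norm_le_rpow hp1 hh.mem.memLp_grad
      ((measurable_finslerFlux (hGf.lipschitzWith hG.upper).continuous.measurable).comp_aemeasurable
        hh.mem.memLp_grad.1.aemeasurable).aestronglyMeasurable
      fun y => hGf.norm_finslerFlux_le hp1 hθ₂.le hG.upper _
  -- All constants are chosen before `ℓ`; `a` makes the term with `∇ψ` at most half
  -- of the coercive term, which absorbs it.
  obtain ⟨K, hK, hpoin⟩ := exists_poincare hω₂_bdd hp
  obtain ⟨M, hM, hcut⟩ := exists_scaled_cutoff hω₁_open hω₁_bdd hω₁_conv hω₁_zero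
  obtain ⟨N, hN, henergy⟩ := exists_energy_bound (α := CylSpace m k) hp1 hc
    (by positivity) hcoer hAgrow
  set Λ := θ₂ ^ p with hΛdef
  have hΛ : 0 < Λ := by positivity
  set a := c / (2 * (Λ * M * (K + 1))) with hadef
  have ha : 0 < a := by positivity
  have hsmall : Λ * a * M * (K + 1) ≤ c / 2 := by
    rw [hadef]
    apply le_of_eq
    field_simp
  obtain ⟨P, hP, hpow⟩ := exists_pow_le_mul_exp m (a := a / 2) (by positivity)
  set J := (volume ω₁).toReal * ∫ y in ω₂, ‖h y‖ ^ p with hJdef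
  have hJ : 0 ≤ J := mul_nonneg ENNReal.toReal_nonneg (integral_nonneg fun y => by positivity)
  have hfin₁ : volume ω₁ ≠ ⊤ := hω₁_bdd.measure_lt_top.ne
  refine ⟨(2 * N * P * (J + 1)) ^ (1 / p), a / (2 * p), by positivity, by positivity, ?_⟩
  intro l hl u hu
  obtain ⟨g, hg, heq⟩ := hu
  have hS : MeasurableSet (l • ω₁) := (hω₁_open.smul₀ hl.ne').measurableSet
  have hS' : MeasurableSet ((l / 2) • ω₁) := (hω₁_open.smul₀ (by positivity)).measurableSet
  have hT : MeasurableSet ω₂ := hω₂_open.measurableSet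
  have hvol : volume (l • ω₁) = ENNReal.ofReal (l ^ m) * volume ω₁ := by
    rw [Measure.addHaar_smul, finrank_euclideanSpace_fin, abs_of_pos (by positivity)]
  have hfin : volume (l • ω₁) ≠ ⊤ := by
    rw [hvol]
    exact ENNReal.mul_ne_top ENNReal.ofReal_ne_top hfin₁
  have hsub : (l / 2) • ω₁ ⊆ l • ω₁ := by
    rintro _ ⟨x, hx, rfl⟩
    refine ⟨(1 / 2 : ℝ) • x, ?_, by simp only [smul_smul]; congr 1; ring⟩
    exact hω₁_conv.smul_mem_of_zero_mem hω₁_zero hx ⟨by norm_num, by norm_num⟩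
  change MemSobolevZero (cyl (l • ω₁) ω₂) p u g at hg
  change ∀ (φ : CylSpace m k → ℝ) gφ, MemSobolevZero (cyl (l • ω₁) ω₂) p φ gφ →
    ∫ x in cyl (l • ω₁) ω₂, ⟪A (g x), gφ x⟫_ℝ = ∫ x in cyl (l • ω₁) ω₂, f x.snd * φ x at heq
  change ∃ D : CylSpace m k → CylSpace m k,
    HasWeakGradient (cyl (l • ω₁) ω₂) (fun x => u x - uInf x.snd) D ∧
      eLpNorm D (ENNReal.ofReal p) (volume.restrict (cyl ((l / 2) • ω₁) ω₂)) ≤ _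
  -- `w = u - uInf` vanishes on the lateral boundary, and its gradient is the required `D`
  have hinf := hh.vanishesLaterally_comp_snd (m := m) hp1 hS hT hfin
  have hw := hg.vanishesLaterally.sub hp1 hinf
  refine ⟨fun x => g x - inrL m k (h x.snd), hw.hasWeakGradient hp1, ?_⟩
  have hAg : MemLp (fun x => A (g x)) (ENNReal.ofReal (p / (p - 1)))
      (volume.restrict (cyl (l • ω₁) ω₂)) :=
    memLp_of_norm_le_rpow hp1 hg.mem.memLp_grad
      (hAmeas.comp_aemeasurable hg.mem.memLp_grad.1.aemeasurable).aestronglyMeasurable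
      fun x => hAgrow _
  have hAg' : MemLp (fun x => A (inrL m k (h x.snd))) (ENNReal.ofReal (p / (p - 1)))
      (volume.restrict (cyl (l • ω₁) ω₂)) :=
    memLp_of_norm_le_rpow hp1 hinf.memLp_grad
      (hAmeas.comp_aemeasurable hinf.memLp_grad.1.aemeasurable).aestronglyMeasurable
      fun x => hAgrow _
  have heqs : ∀ φ gφ, MemSobolevZero (cyl (l • ω₁) ω₂) p φ gφ →
      ∫ x in cyl (l • ω₁) ω₂, ⟪A (g x), gφ x⟫_ℝ =
        ∫ x in cyl (l • ω₁) ω₂, ⟪A (inrL m k (h x.snd)), gφ x⟫_ℝ := by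
    intro φ gφ hφ
    rw [heq φ gφ hφ, ← integral_cyl_eq_of_cross_section hp1 hS hT hfin hGflux hf
      (fun χ hχ => ?_) hφ]
    · simp only [hAinr]
    · have := heqInf χ _ (hχ.memSobolevZero hp1)
      simpa only [hcross] using this
  have hbound := henergy _ g (fun x => inrL m k (h x.snd)) hg.mem.memLp_grad hinf.memLp_grad
    hAg hAg' (heqs u g hg)
  obtain ⟨ψ, hψ, hψ₀, hψM, hψl⟩ := hcut l hl
  obtain ⟨hi, hweight⟩ := integral_exp_mul_le hp1 hc hΛ hK ha hsmall hS hT hmono hAfst hpoin hψ hψ₀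
    hψM hw (fun x => inrL_fst _) hAg hAg' heqs
  rw [integral_norm_rpow_comp_snd hp0 hS hT hfin hh.mem.memLp_grad, hvol, ENNReal.toReal_mul,
    ENNReal.toReal_ofReal (by positivity), mul_assoc, ← hJdef] at hbound
  have hE := hweight.trans (mul_le_mul_of_nonneg_left hbound zero_le_two)
  refine (eLpNorm_le_of_integral_exp_mul_le hp0 hS' hT hsub hψl hw.memLp_grad hi hE).trans ?_
  refine ENNReal.ofReal_le_ofReal ?_
  -- half of the exponential rate is spent on the factor `l ^ m`
  have hfinal : 2 * (N * (l ^ m * J)) * Real.exp (-(a * l)) ≤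
      2 * N * P * (J + 1) * Real.exp (-(a * l) / 2) := by
    calc 2 * (N * (l ^ m * J)) * Real.exp (-(a * l))
        ≤ 2 * (N * ((P * Real.exp (a / 2 * l)) * (J + 1))) * Real.exp (-(a * l)) := by
          gcongr
          · exact hpow l hl.le
          · linarith
      _ = 2 * N * P * (J + 1) * (Real.exp (a / 2 * l) * Real.exp (-(a * l))) := by ring
      _ = _ := by
          rw [← Real.exp_add]
          congr 2
          ring
  calc (2 * (N * (l ^ m * J)) * Real.exp (-(a * l))) ^ (1 / p)
      ≤ (2 * N * P * (J + 1) * Real.exp (-(a * l) / 2)) ^ (1 / p) := by gcongr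
    _ = (2 * N * P * (J + 1)) ^ (1 / p) * Real.exp (-(a / (2 * p)) * l) := by
        rw [Real.mul_rpow (by positivity) (Real.exp_pos _).le, ← Real.exp_mul]
        congr 2
        field_simp
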